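/- Let $(M^m,g)$ and $(N^n,h)$ be smooth finite-dimensional Riemannian manifolds without boundary, $M$ connected, and let $f:M\to(0,\infty)$ be smooth. A smooth map $\varphi:M\to N$ is called $f$-harmonic (respectively harmonic, respectively $p$-harmonic) if for every compact $\Omega\subseteq M$ it is a critical point, with respect to all smooth variations supported in $\Omega$, of the energy $\frac12\int_\Omega f\,|d\varphi|^2\,dv_g$ (respectively $\frac12\int_\Omega|d\varphi|^2\,dv_g$, respectively $\frac1p\int_\Omega|d\varphi|^p\,dv_g$), where $|d\varphi|^2=\mathrm{Tr}_g(\varphi^*h)$. An immersion $\varphi$ is called minimal if, in the same sense, it is a critical point of the volume $\int_\Omega dv_{\varphi^*h}$. (1) Let $\varphi:(M,g)\to(N,h)$ be a smooth conformal immersion with $\varphi^*h=\lambda^2 g$, where $\lambda:M\to(0,\infty)$. Then $\varphi$ is $f$-harmonic if and only if $\varphi$ is $m$-harmonic and $f=C\lambda^{m-2}$ on $M$ for some constant $C$. Moreover, $\varphi$ is $m$-harmonic if and only if it is minimal. (2) Let $\varphi:(M,g)\to(N,h)$ be a smooth isometric immersion, i.e. $\varphi^*h=g$. Then $\varphi$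 is $f$-harmonic if and only if $f$ is constant and $\varphi$ is harmonic. -/

import Mathlib

open Set MeasureTheory Bundle Manifold
open scoped ContDiff

noncomputable section

section MetricDefs

variable {m n : ℕ}
  {M : Type*} [TopologicalSpace M] [ChartedSpace (EuclideanSpace ℝ (Fin m)) M]
  [IsManifold (𝓡 m) ∞ M]
  {N : Type*} [TopologicalSpace N] [ChartedSpace (EuclideanSpace ℝ (Fin n)) N]
  [IsManifold (𝓡 n) ∞ N]

/-- Smooth Riemannian metrics on a smooth `m`-dimensional manifold `M` without boundary. -/
abbrev RMetric (m : ℕ) (M : Type*) [TopologicalSpace M]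
    [ChartedSpace (EuclideanSpace ℝ (Fin m)) M] [IsManifold (𝓡 m) ∞ M] :=
  ContMDiffRiemannianMetric (𝓡 m) ∞ (EuclideanSpace ℝ (Fin m))
    (fun x : M => TangentSpace (𝓡 m) x)

/-- The basis of `T_x M` given by the coordinate vectors of the preferred chart at `x`
(Mathlib identifies `T_x M` with the model space by means of that chart). -/
def frameVec (x : M) (i : Fin m) : TangentSpace (𝓡 m) x :=
  (EuclideanSpace.single i (1 : ℝ) : EuclideanSpace ℝ (Fin m))

/-- The Gram matrix `g_x(e_i, e_j)` of the metric in the basis `frameVec x`. -/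
def metricGram (g : RMetric m M) (x : M) : Matrix (Fin m) (Fin m) ℝ :=
  Matrix.of fun i j => g.inner x (frameVec (m := m) x i) (frameVec (m := m) x j)

/-- The matrix `(φ^* h)_x(e_i, e_j) = h(dφ e_i, dφ e_j)` of the pulled back form in the same
basis. -/
def pullbackGram (h : RMetric n N) (φ : M → N) (x : M) : Matrix (Fin m) (Fin m) ℝ :=
  Matrix.of fun i j => h.inner (φ x)
    (mfderiv (𝓡 m) (𝓡 n) φ x (frameVec (m := m) x i))
    (mfderiv (𝓡 m) (𝓡 n) φ x (frameVec (m := m) x j))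

/-- `|dφ|² = Tr_g (φ^* h)` at `x`, the squared Hilbert-Schmidt norm of `dφ_x`
(independent of the basis). -/
def normSqD (g : RMetric m M) (h : RMetric n N) (φ : M → N) (x : M) : ℝ :=
  ((metricGram g x)⁻¹ * pullbackGram h φ x).trace

/-- The Jacobian `√(det (φ^* h) / det g)` of `φ` at `x`: the density of the `m`-dimensional volume
of `φ^* h` with respect to that of `g` (independent of the basis). -/
def jacobianD (g : RMetric m M) (h : RMetric n N) (φ : M → N) (x : M) : ℝ :=
  √((pullbackGram (m := m) h φ x).det / (metricGram g x).det)

/-- The matrix `g_ij(y) = g(∂_i, ∂_j)` of the metric in the chart `chartAt x₀`, at the point with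
coordinates `y`. -/
def chartGram (g : RMetric m M) (x₀ : M) (y : EuclideanSpace ℝ (Fin m)) :
    Matrix (Fin m) (Fin m) ℝ :=
  let c := chartAt (EuclideanSpace ℝ (Fin m)) x₀
  Matrix.of fun i j => g.inner (c.symm y)
    (mfderiv (𝓡 m) (𝓡 m) c.symm y (frameVec (m := m) y i))
    (mfderiv (𝓡 m) (𝓡 m) c.symm y (frameVec (m := m) y j))

/-- The coordinate volume `√(det g_ij) dy¹ ⋯ dyᵐ` of the chart `chartAt x₀`, as a measure on `M`
concentrated on the domain of that chart. -/
def chartVolume [MeasurableSpace M] (g : RMetric m M) (x₀ : M) : Measure M :=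
  (((volume : Measure (EuclideanSpace ℝ (Fin m))).withDensity
      fun y => ENNReal.ofReal √((chartGram g x₀ y).det)).restrict
    (chartAt (EuclideanSpace ℝ (Fin m)) x₀).target).map
    (chartAt (EuclideanSpace ℝ (Fin m)) x₀).symm

/-- The Riemannian volume measure `dv_g`. By the change of variables formula the coordinate volumes
of two charts agree on the overlap of their domains, so the supremum of all of them (in the complete
lattice of measures) is the one measure that restricts to `√(det g_ij) dy¹ ⋯ dyᵐ` on the domain of
every chart. -/
def riemannianVolume [MeasurableSpace M] (g : RMetric m M) : Measure M :=
  ⨆ x₀ : M, chartVolume g x₀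

/-- The `f`-energy `E_f(φ; Ω) = ½ ∫_Ω f |dφ|² dv_g`. -/
def fEnergy [MeasurableSpace M] (g : RMetric m M) (h : RMetric n N) (f : M → ℝ)
    (Ω : Set M) (φ : M → N) : ℝ :=
  (1 / 2) * ∫ x in Ω, f x * normSqD g h φ x ∂(riemannianVolume g)

/-- The `p`-energy `E_p(φ; Ω) = (1 / p) ∫_Ω |dφ|^p dv_g`. -/
def pEnergy [MeasurableSpace M] (g : RMetric m M) (h : RMetric n N) (p : ℝ)
    (Ω : Set M) (φ : M → N) : ℝ :=
  (1 / p) * ∫ x in Ω, (√(normSqD g h φ x)) ^ p ∂(riemannianVolume g)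

/-- The `m`-dimensional volume of `φ` over `Ω`, i.e. the volume of `Ω` for `φ^* h`. -/
def volumeFunctional [MeasurableSpace M] (g : RMetric m M) (h : RMetric n N)
    (Ω : Set M) (φ : M → N) : ℝ :=
  ∫ x in Ω, jacobianD g h φ x ∂(riemannianVolume g)

/-- `Φ` is a smooth one-parameter variation of `φ`, defined for `|t| < ε` and supported in `Ω`. -/
structure IsVariation (m n : ℕ) {M : Type*} [TopologicalSpace M]
    [ChartedSpace (EuclideanSpace ℝ (Fin m)) M]
    {N : Type*} [TopologicalSpace N] [ChartedSpace (EuclideanSpace ℝ (Fin n)) N]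
    (φ : M → N) (Ω : Set M) (ε : ℝ) (Φ : ℝ → M → N) : Prop where
  pos : 0 < ε
  smooth : ContMDiffOn (𝓘(ℝ, ℝ).prod (𝓡 m)) (𝓡 n) ∞ (fun q : ℝ × M => Φ q.1 q.2)
    (Ioo (-ε) ε ×ˢ univ)
  zero : Φ 0 = φ
  support : ∀ t ∈ Ioo (-ε) ε, ∀ x ∉ Ω, Φ t x = φ x

/-- The smooth map `φ` is a critical point of the functional `𝓔 Ω` with respect to all variations
supported in `Ω`, for every compact `Ω ⊆ M`. -/
def IsCriticalMap (m n : ℕ) {M : Type*} [TopologicalSpace M]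
    [ChartedSpace (EuclideanSpace ℝ (Fin m)) M]
    {N : Type*} [TopologicalSpace N] [ChartedSpace (EuclideanSpace ℝ (Fin n)) N]
    (𝓔 : Set M → (M → N) → ℝ) (φ : M → N) : Prop :=
  ContMDiff (𝓡 m) (𝓡 n) ∞ φ ∧
    ∀ Ω : Set M, IsCompact Ω → ∀ (ε : ℝ) (Φ : ℝ → M → N), IsVariation m n φ Ω ε Φ →
      HasDerivAt (fun t : ℝ => 𝓔 Ω (Φ t)) 0 0

/-- `f`-harmonic maps `(M, g) → (N, h)`. -/
def IsFHarmonic [MeasurableSpace M] (g : RMetric m M) (h : RMetric n N) (f : M → ℝ)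
    (φ : M → N) : Prop :=
  IsCriticalMap m n (fEnergy g h f) φ

/-- Harmonic maps: critical points of the energy `½ ∫ |dφ|² dv_g`. -/
def IsHarmonicMap [MeasurableSpace M] (g : RMetric m M) (h : RMetric n N) (φ : M → N) : Prop :=
  IsCriticalMap m n (fEnergy g h fun _ => 1) φ

/-- `p`-harmonic maps: critical points of the `p`-energy. -/
def IsPHarmonic [MeasurableSpace M] (g : RMetric m M) (h : RMetric n N) (p : ℝ)
    (φ : M → N) : Prop :=
  IsCriticalMap m n (pEnergy g h p) φ

/-- Minimality of an immersion: it is a critical point of the volume. -/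
def IsMinimalMap [MeasurableSpace M] (g : RMetric m M) (h : RMetric n N) (φ : M → N) : Prop :=
  IsCriticalMap m n (volumeFunctional g h) φ

/-- `φ` is a (smooth) conformal immersion with `φ^* h = lam² g`, `lam > 0`. -/
structure IsConformalImmersion (g : RMetric m M) (h : RMetric n N) (φ : M → N) (lam : M → ℝ) :
    Prop where
  smooth : ContMDiff (𝓡 m) (𝓡 n) ∞ φ
  immersion : ∀ x, Function.Injective (mfderiv (𝓡 m) (𝓡 n) φ x)
  pos : ∀ x, 0 < lam x
  pullback : ∀ (x : M) (v w : TangentSpace (𝓡 m) x),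
    h.inner (φ x) (mfderiv (𝓡 m) (𝓡 n) φ x v) (mfderiv (𝓡 m) (𝓡 n) φ x w)
      = lam x ^ 2 * g.inner x v w

/-- `φ` is a (smooth) isometric immersion: `φ^* h = g`. -/
structure IsIsometricImmersion (g : RMetric m M) (h : RMetric n N) (φ : M → N) : Prop where
  smooth : ContMDiff (𝓡 m) (𝓡 n) ∞ φ
  immersion : ∀ x, Function.Injective (mfderiv (𝓡 m) (𝓡 n) φ x)
  pullback : ∀ (x : M) (v w : TangentSpace (𝓡 m) x),
    h.inner (φ x) (mfderiv (𝓡 m) (𝓡 n) φ x v) (mfderiv (𝓡 m) (𝓡 n) φ x w) = g.inner x v w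

end MetricDefs

end

/-! For a variation Φ_t of φ put A(t) = G⁻¹P(t), where G and P(t) are the Gram matrices of g and
Φ_t^*h. Then |dΦ_t|² = tr A(t), and the Jacobian is √det A(t). Conformality means A(0) = λ²·1, and
at a scalar matrix the derivative of det is a multiple of the trace. Writing e' for the derivative
of |dΦ_t|² at t = 0, the Jacobian therefore has derivative ½λ^(m-2)e', and |dΦ_t|^m has derivative a
constant times λ^(m-2)e' (`hasDerivAt_jacobianD`, `hasDerivAt_pDensity`).

So all the functionals have first variation ∫ w e' up to a constant factor, with w = f for the
f-energy and w = λ^(m-2) for the volume and the m-energy (`HasZeroFirstVariation`). Minimality and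
m-harmonicity become the same condition, and the weights f and Cλ^(m-2) are interchangeable when C ≠
0.

It remains to see that f-harmonicity forces u = f/λ^(m-2) to be constant. Test with tangential
variations, which precompose φ with y ↦ y + tη(y)v in a chart. If ρ is the density of φ^*h, the
change of volume density is ∂_v(ρη) to first order (`density_mul_normSqVariation`), so ∫ u ∂_v(ρη) =
0 for every bump function η. Integration by parts gives ∂_v u = 0, and M is connected
(`exists_eq_const_mul`). The isometric case is λ = 1. -/

noncomputable section

/-! ### Gram matrices and change of basis -/

/-- The matrix of a linear map between Euclidean spaces in the standard bases. -/
def coordMatrix {m n : ℕ} (A : EuclideanSpace ℝ (Fin m) →L[ℝ] EuclideanSpace ℝ (Fin n)) :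
    Matrix (Fin n) (Fin m) ℝ :=
  Matrix.of fun k i => A (EuclideanSpace.single i (1 : ℝ)) k

lemma det_coordMatrix {m : ℕ} (A : EuclideanSpace ℝ (Fin m) →L[ℝ] EuclideanSpace ℝ (Fin m)) :
    (coordMatrix A).det = A.det := by
  have : coordMatrix A = LinearMap.toMatrix (EuclideanSpace.basisFun (Fin m) ℝ).toBasis
      (EuclideanSpace.basisFun (Fin m) ℝ).toBasis (A : _ →ₗ[ℝ] _) := by
    ext i j
    simp [coordMatrix, LinearMap.toMatrix_apply]
  rw [this, LinearMap.det_toMatrix]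

lemma gram_comp {m n : ℕ}
    (B : EuclideanSpace ℝ (Fin n) →L[ℝ] EuclideanSpace ℝ (Fin n) →L[ℝ] ℝ)
    (A : EuclideanSpace ℝ (Fin m) →L[ℝ] EuclideanSpace ℝ (Fin n)) :
    (Matrix.of fun i j => B (A (EuclideanSpace.single i (1 : ℝ)))
      (A (EuclideanSpace.single j (1 : ℝ))) : Matrix (Fin m) (Fin m) ℝ) =
    (coordMatrix A).transpose * (Matrix.of fun i j => B (EuclideanSpace.single i (1 : ℝ))
      (EuclideanSpace.single j (1 : ℝ)) : Matrix (Fin n) (Fin n) ℝ) * coordMatrix A := by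
  have key : ∀ v : EuclideanSpace ℝ (Fin n),
      v = ∑ k, v k • (EuclideanSpace.single k (1 : ℝ) : EuclideanSpace ℝ (Fin n)) := fun v => by
    have := (EuclideanSpace.basisFun (Fin n) ℝ).sum_repr v
    simpa using this.symm
  ext i j
  simp only [Matrix.of_apply]
  conv_lhs => rw [key (A (EuclideanSpace.single i 1)), key (A (EuclideanSpace.single j 1))]
  simp only [map_sum, map_smul, _root_.sum_apply, _root_.smul_apply,
    smul_eq_mul, Matrix.mul_apply, Matrix.transpose_apply, Matrix.of_apply, coordMatrix]
  refine Finset.sum_congr rfl fun k _ => ?_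
  rw [Finset.mul_sum, Finset.sum_mul, Finset.sum_congr rfl]
  intro l _
  ring

section Gram

set_option linter.unusedSectionVars false

variable {m n k : ℕ}
  {M : Type*} [TopologicalSpace M] [ChartedSpace (EuclideanSpace ℝ (Fin m)) M]
  [IsManifold (𝓡 m) ∞ M]
  {N : Type*} [TopologicalSpace N] [ChartedSpace (EuclideanSpace ℝ (Fin n)) N]
  [IsManifold (𝓡 n) ∞ N]
  {K : Type*} [TopologicalSpace K] [ChartedSpace (EuclideanSpace ℝ (Fin k)) K]
  [IsManifold (𝓡 k) ∞ K]

variable (m n) in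
/-- The matrix of the differential of a map between manifolds in the bases `frameVec`. -/
def jacMatrix (φ : M → N) (x : M) : Matrix (Fin n) (Fin m) ℝ :=
  coordMatrix (show EuclideanSpace ℝ (Fin m) →L[ℝ] EuclideanSpace ℝ (Fin n) from
    mfderiv (𝓡 m) (𝓡 n) φ x)

lemma jacMatrix_eq_fderiv (φ : EuclideanSpace ℝ (Fin m) → EuclideanSpace ℝ (Fin n))
    (x : EuclideanSpace ℝ (Fin m)) : jacMatrix m n φ x = coordMatrix (fderiv ℝ φ x) := by
  unfold jacMatrix
  rw [mfderiv_eq_fderiv]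

lemma pullbackGram_comp (h : RMetric n N) {φ : M → N} {ψ : K → M} {x : K}
    (hφ : MDifferentiableAt (𝓡 m) (𝓡 n) φ (ψ x)) (hψ : MDifferentiableAt (𝓡 k) (𝓡 m) ψ x) :
    pullbackGram (m := k) h (φ ∘ ψ) x =
      (jacMatrix k m ψ x).transpose * pullbackGram (m := m) h φ (ψ x) * jacMatrix k m ψ x := by
  have h1 := mfderiv_comp x hφ hψ
  unfold pullbackGram
  rw [h1]
  let D : EuclideanSpace ℝ (Fin m) →L[ℝ] EuclideanSpace ℝ (Fin n) :=
    mfderiv (𝓡 m) (𝓡 n) φ (ψ x)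
  let B : EuclideanSpace ℝ (Fin n) →L[ℝ] EuclideanSpace ℝ (Fin n) →L[ℝ] ℝ := h.inner (φ (ψ x))
  exact gram_comp ((ContinuousLinearMap.compL ℝ _ _ ℝ).flip D ∘L B ∘L D)
    (mfderiv (𝓡 k) (𝓡 m) ψ x)

lemma pullbackGram_congr (h : RMetric n N) {φ ψ : M → N} {x : M} (hφ : φ =ᶠ[nhds x] ψ) :
    pullbackGram (m := m) h φ x = pullbackGram (m := m) h ψ x := by
  unfold pullbackGram
  rw [hφ.mfderiv_eq, hφ.eq_of_nhds]

lemma pullbackGram_id (g : RMetric m M) (x : M) : pullbackGram g id x = metricGram g x := by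
  unfold pullbackGram metricGram
  rw [mfderiv_id]
  rfl

lemma mdifferentiableAt_chart_symm (x₀ : M) {y : EuclideanSpace ℝ (Fin m)}
    (hy : y ∈ (chartAt (EuclideanSpace ℝ (Fin m)) x₀).target) :
    MDifferentiableAt (𝓡 m) (𝓡 m) (chartAt (EuclideanSpace ℝ (Fin m)) x₀).symm y :=
  mdifferentiableAt_atlas_symm (chart_mem_atlas _ x₀) hy

lemma det_jacMatrix_chart_symm_ne_zero (x₀ : M) {y : EuclideanSpace ℝ (Fin m)}
    (hy : y ∈ (chartAt (EuclideanSpace ℝ (Fin m)) x₀).target) :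
    (jacMatrix m m (chartAt (EuclideanSpace ℝ (Fin m)) x₀).symm y).det ≠ 0 := by
  unfold jacMatrix
  rw [det_coordMatrix]
  have h1 := (mdifferentiable_chart (I := 𝓡 m) x₀).symm.mfderiv_bijective hy
  let A : EuclideanSpace ℝ (Fin m) →L[ℝ] EuclideanSpace ℝ (Fin m) :=
    mfderiv (𝓡 m) (𝓡 m) (chartAt (EuclideanSpace ℝ (Fin m)) x₀).symm y
  let e := LinearEquiv.ofBijective (A : EuclideanSpace ℝ (Fin m) →ₗ[ℝ] EuclideanSpace ℝ (Fin m)) h1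
  exact (LinearEquiv.isUnit_det' e).ne_zero

lemma chartGram_eq (g : RMetric m M) (x₀ : M) {y : EuclideanSpace ℝ (Fin m)}
    (hy : y ∈ (chartAt (EuclideanSpace ℝ (Fin m)) x₀).target) :
    chartGram g x₀ y = (jacMatrix m m (chartAt (EuclideanSpace ℝ (Fin m)) x₀).symm y).transpose *
      metricGram g ((chartAt (EuclideanSpace ℝ (Fin m)) x₀).symm y) *
      jacMatrix m m (chartAt (EuclideanSpace ℝ (Fin m)) x₀).symm y := by
  rw [← pullbackGram_id]
  exact pullbackGram_comp g mdifferentiableAt_id (mdifferentiableAt_chart_symm x₀ hy)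

lemma metricGram_posDef (g : RMetric m M) (x : M) : (metricGram g x).PosDef := by
  let B : EuclideanSpace ℝ (Fin m) →L[ℝ] EuclideanSpace ℝ (Fin m) →L[ℝ] ℝ := g.inner x
  refine Matrix.PosDef.of_dotProduct_mulVec_pos ?_ ?_
  · ext i j
    exact g.symm x _ _
  · intro v hv
    have h2 : WithLp.toLp 2 v ≠ (0 : EuclideanSpace ℝ (Fin m)) := by
      simpa using hv
    have h1 : 0 < B (WithLp.toLp 2 v) (WithLp.toLp 2 v) := g.pos x (WithLp.toLp 2 v) h2
    have h3 : (WithLp.toLp 2 v : EuclideanSpace ℝ (Fin m)) =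
        ∑ i, v i • (EuclideanSpace.single i (1 : ℝ) : EuclideanSpace ℝ (Fin m)) := by
      simpa using ((EuclideanSpace.basisFun (Fin m) ℝ).sum_repr (WithLp.toLp 2 v)).symm
    have h4 : metricGram g x = Matrix.of fun i j => B (EuclideanSpace.single i (1 : ℝ))
      (EuclideanSpace.single j (1 : ℝ)) := rfl
    rw [h3] at h1
    have h5 : star v ⬝ᵥ (metricGram g x).mulVec v =
        B (∑ i, v i • (EuclideanSpace.single i (1 : ℝ) : EuclideanSpace ℝ (Fin m)))
          (∑ i, v i • (EuclideanSpace.single i (1 : ℝ) : EuclideanSpace ℝ (Fin m))) := by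
      rw [h4]
      simp only [dotProduct, Matrix.mulVec, Matrix.of_apply, map_sum, map_smul,
        _root_.sum_apply, _root_.smul_apply, smul_eq_mul, star_trivial]
      refine Finset.sum_congr rfl fun i _ => congrArg _ (Finset.sum_congr rfl fun j _ => ?_)
      rw [mul_comm]
      exact congrArg _ (g.symm x _ _)
    rwa [h5]

lemma det_chartGram_pos (g : RMetric m M) (x₀ : M) {y : EuclideanSpace ℝ (Fin m)}
    (hy : y ∈ (chartAt (EuclideanSpace ℝ (Fin m)) x₀).target) : 0 < (chartGram g x₀ y).det := by
  rw [chartGram_eq g x₀ hy, Matrix.det_mul, Matrix.det_mul, Matrix.det_transpose]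
  have h1 := (metricGram_posDef g ((chartAt (EuclideanSpace ℝ (Fin m)) x₀).symm y)).det_pos
  have h2 := det_jacMatrix_chart_symm_ne_zero x₀ hy
  have h3 := mul_self_pos.2 h2
  nlinarith [mul_pos h1 h3]

/-- A change of basis S replaces the endomorphism G⁻¹P by its conjugate S⁻¹(G⁻¹P)S. -/
lemma trace_inv_mul_conj {S G P : Matrix (Fin m) (Fin m) ℝ} (hS : S.det ≠ 0) :
    ((S.transpose * G * S)⁻¹ * (S.transpose * P * S)).trace = (G⁻¹ * P).trace := by
  have hS' : IsUnit S.det := isUnit_iff_ne_zero.2 hS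
  have hT : IsUnit S.transpose.det := by rwa [Matrix.det_transpose]
  rw [Matrix.mul_inv_rev, Matrix.mul_inv_rev]
  have : S⁻¹ * (G⁻¹ * S.transpose⁻¹) * (S.transpose * P * S) = S⁻¹ * ((G⁻¹ * P) * S) := by
    simp only [Matrix.mul_assoc]
    rw [Matrix.nonsing_inv_mul_cancel_left _ _ hT]
  rw [this, Matrix.trace_mul_comm, Matrix.mul_assoc, Matrix.mul_nonsing_inv _ hS', Matrix.mul_one]

/-- The basis `frameVec x` comes from the preferred chart at x and may jump with x, so the entries
of `metricGram` need not be continuous. Smoothness has to be read off in one fixed chart, which is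
harmless because the trace is invariant; `det_div_det_chart` does the same for the determinant. -/
lemma normSqD_chart (g : RMetric m M) (h : RMetric n N) {φ : M → N} (x₀ : M)
    {y : EuclideanSpace ℝ (Fin m)} (hy : y ∈ (chartAt (EuclideanSpace ℝ (Fin m)) x₀).target)
    (hφ : MDifferentiableAt (𝓡 m) (𝓡 n) φ ((chartAt (EuclideanSpace ℝ (Fin m)) x₀).symm y)) :
    normSqD g h φ ((chartAt (EuclideanSpace ℝ (Fin m)) x₀).symm y) =
      ((chartGram g x₀ y)⁻¹ * pullbackGram (m := m) h
        (φ ∘ (chartAt (EuclideanSpace ℝ (Fin m)) x₀).symm) y).trace := by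
  rw [pullbackGram_comp h hφ (mdifferentiableAt_chart_symm x₀ hy), chartGram_eq g x₀ hy,
    trace_inv_mul_conj (det_jacMatrix_chart_symm_ne_zero x₀ hy)]
  rfl

lemma det_div_det_chart (g : RMetric m M) (h : RMetric n N) {φ : M → N} (x₀ : M)
    {y : EuclideanSpace ℝ (Fin m)} (hy : y ∈ (chartAt (EuclideanSpace ℝ (Fin m)) x₀).target)
    (hφ : MDifferentiableAt (𝓡 m) (𝓡 n) φ ((chartAt (EuclideanSpace ℝ (Fin m)) x₀).symm y)) :
    (pullbackGram (m := m) h φ ((chartAt (EuclideanSpace ℝ (Fin m)) x₀).symm y)).det /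
        (metricGram g ((chartAt (EuclideanSpace ℝ (Fin m)) x₀).symm y)).det =
      (pullbackGram (m := m) h (φ ∘ (chartAt (EuclideanSpace ℝ (Fin m)) x₀).symm) y).det /
        (chartGram g x₀ y).det := by
  rw [pullbackGram_comp h hφ (mdifferentiableAt_chart_symm x₀ hy), chartGram_eq g x₀ hy]
  simp only [Matrix.det_mul, Matrix.det_transpose]
  have h2 := det_jacMatrix_chart_symm_ne_zero x₀ hy
  have h1 := (metricGram_posDef g ((chartAt (EuclideanSpace ℝ (Fin m)) x₀).symm y)).det_pos.ne'
  field_simp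

end Gram

/-! ### Smoothness of the energy and volume densities -/

section Smooth

set_option linter.unusedSectionVars false

variable {m n : ℕ}
  {M : Type*} [TopologicalSpace M] [ChartedSpace (EuclideanSpace ℝ (Fin m)) M]
  [IsManifold (𝓡 m) ∞ M]
  {N : Type*} [TopologicalSpace N] [ChartedSpace (EuclideanSpace ℝ (Fin n)) N]
  [IsManifold (𝓡 n) ∞ N]

/-- This is the tangent map of the inverse chart applied to a constant vector field. -/
lemma contMDiffOn_mfderiv_chart_symm_frameVec (x₀ : M) (i : Fin m) :
    ContMDiffOn (𝓡 m) ((𝓡 m).prod 𝓘(ℝ, EuclideanSpace ℝ (Fin m))) ∞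
      (fun y => (TotalSpace.mk' (EuclideanSpace ℝ (Fin m))
        ((chartAt (EuclideanSpace ℝ (Fin m)) x₀).symm y)
        (mfderiv (𝓡 m) (𝓡 m) (chartAt (EuclideanSpace ℝ (Fin m)) x₀).symm y
          (frameVec (m := m) y i)) : TangentBundle (𝓡 m) M))
      (chartAt (EuclideanSpace ℝ (Fin m)) x₀).target := by
  have h1 : ContMDiffOn (𝓡 m) (𝓡 m) ∞ (chartAt (EuclideanSpace ℝ (Fin m)) x₀).symm
    (chartAt (EuclideanSpace ℝ (Fin m)) x₀).target := contMDiffOn_chart_symm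
  have hopen := (chartAt (EuclideanSpace ℝ (Fin m)) x₀).open_target
  have h2 := h1.contMDiffOn_tangentMapWithin (m := ∞) (by simp) hopen.uniqueMDiffOn
  have h3 : ContMDiff (𝓡 m) ((𝓡 m).prod 𝓘(ℝ, EuclideanSpace ℝ (Fin m))) ∞
      (fun y : EuclideanSpace ℝ (Fin m) => (⟨y, frameVec (m := m) y i⟩ :
        TangentBundle (𝓡 m) (EuclideanSpace ℝ (Fin m)))) := by
    intro y
    exact contMDiffAt_vectorSpace_iff_contDiffAt.2 contDiffAt_const
  have h4 := h2.comp h3.contMDiffOn (s := (chartAt (EuclideanSpace ℝ (Fin m)) x₀).target)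
    (fun y hy => hy)
  refine h4.congr fun y hy => ?_
  simp only [Function.comp, tangentMapWithin]
  rw [mfderivWithin_of_isOpen hopen hy]

lemma contDiffOn_chartGram (g : RMetric m M) (x₀ : M) (i j : Fin m) :
    ContDiffOn ℝ ∞ (fun y => chartGram g x₀ y i j)
      (chartAt (EuclideanSpace ℝ (Fin m)) x₀).target := by
  rw [← contMDiffOn_iff_contDiffOn]
  have h1 : ContMDiffOn (𝓡 m) (𝓡 m) ∞ (chartAt (EuclideanSpace ℝ (Fin m)) x₀).symm
    (chartAt (EuclideanSpace ℝ (Fin m)) x₀).target := contMDiffOn_chart_symm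
  have h2 := g.contMDiff.comp_contMDiffOn h1
  have h3 := ContMDiffOn.clm_bundle_apply₂ (F₁ := EuclideanSpace ℝ (Fin m))
    (F₂ := EuclideanSpace ℝ (Fin m)) (F₃ := ℝ) (E₃ := Bundle.Trivial M ℝ) h2
    (contMDiffOn_mfderiv_chart_symm_frameVec x₀ i)
    (contMDiffOn_mfderiv_chart_symm_frameVec x₀ j)
  intro y hy
  have h4 := h3 y hy
  rw [Bundle.contMDiffWithinAt_totalSpace] at h4
  exact h4.2

lemma contDiffAt_comp_chart_symm {f : M → ℝ} (hf : ContMDiff (𝓡 m) 𝓘(ℝ, ℝ) ∞ f) (x₀ : M)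
    {y : EuclideanSpace ℝ (Fin m)} (hy : y ∈ (chartAt (EuclideanSpace ℝ (Fin m)) x₀).target) :
    ContDiffAt ℝ ∞ (fun y => f ((chartAt (EuclideanSpace ℝ (Fin m)) x₀).symm y)) y := by
  rw [← contMDiffAt_iff_contDiffAt]
  exact ContMDiffAt.comp y (hf _) (contMDiffOn_chart_symm.contMDiffAt
    ((chartAt (EuclideanSpace ℝ (Fin m)) x₀).open_target.mem_nhds hy))

lemma contDiffAt_det {E : Type*} [NormedAddCommGroup E] [NormedSpace ℝ E]
    {A : E → Matrix (Fin m) (Fin m) ℝ} {x : E}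
    (hA : ∀ i j, ContDiffAt ℝ ∞ (fun y => A y i j) x) : ContDiffAt ℝ ∞ (fun y => (A y).det) x := by
  simp only [Matrix.det_apply]
  exact ContDiffAt.sum fun σ _ => ContDiffAt.const_smul _ (contDiffAt_prod fun i _ => hA _ _)

lemma contDiffAt_adjugate {E : Type*} [NormedAddCommGroup E] [NormedSpace ℝ E]
    {A : E → Matrix (Fin m) (Fin m) ℝ} {x : E}
    (hA : ∀ i j, ContDiffAt ℝ ∞ (fun y => A y i j) x) (i j : Fin m) :
    ContDiffAt ℝ ∞ (fun y => (A y).adjugate i j) x := by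
  simp only [Matrix.adjugate_apply]
  refine contDiffAt_det fun k l => ?_
  by_cases hk : k = j
  · subst hk
    simp only [Matrix.updateRow_self]
    exact contDiffAt_const
  · simp only [Matrix.updateRow_ne hk]
    exact hA k l

lemma contDiffAt_trace_inv_mul {E : Type*} [NormedAddCommGroup E] [NormedSpace ℝ E]
    {A P : E → Matrix (Fin m) (Fin m) ℝ} {x : E}
    (hA : ∀ i j, ContDiffAt ℝ ∞ (fun y => A y i j) x)
    (hP : ∀ i j, ContDiffAt ℝ ∞ (fun y => P y i j) x) (h0 : (A x).det ≠ 0) :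
    ContDiffAt ℝ ∞ (fun y => ((A y)⁻¹ * P y).trace) x := by
  simp only [Matrix.trace, Matrix.diag_apply, Matrix.mul_apply, Matrix.inv_def, Matrix.smul_apply,
    smul_eq_mul, Ring.inverse_eq_inv]
  exact ContDiffAt.sum fun i _ => ContDiffAt.sum fun j _ =>
    (((contDiffAt_det hA).inv h0).mul (contDiffAt_adjugate hA i j)).mul (hP j i)

/-- In a chart of N fixed at F t y the map becomes a smooth ψ between vector spaces, and the pulled
back Gram matrix is JᵀGJ, with J the Jacobian of ψ in y and G the Gram matrix of h in that chart,
evaluated at ψ. -/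
lemma contDiffAt_pullbackGram (h : RMetric n N) {F : ℝ → EuclideanSpace ℝ (Fin m) → N} {t : ℝ}
    {y : EuclideanSpace ℝ (Fin m)}
    (hF : ContMDiffAt (𝓘(ℝ, ℝ).prod (𝓡 m)) (𝓡 n) ∞
      (fun q : ℝ × EuclideanSpace ℝ (Fin m) => F q.1 q.2) (t, y)) (i j : Fin m) :
    ContDiffAt ℝ ∞ (fun q : ℝ × EuclideanSpace ℝ (Fin m) =>
      pullbackGram (m := m) h (F q.1) q.2 i j) (t, y) := by
  set d := chartAt (EuclideanSpace ℝ (Fin n)) (F t y) with hd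
  let ψ : ℝ × EuclideanSpace ℝ (Fin m) → EuclideanSpace ℝ (Fin n) := fun q => d (F q.1 q.2)
  have hsrc : ∀ᶠ q in nhds (t, y), F q.1 q.2 ∈ d.source :=
    hF.continuousAt.preimage_mem_nhds (d.open_source.mem_nhds (mem_chart_source _ (F t y)))
  have hψ : ContDiffAt ℝ ∞ ψ (t, y) := by
    rw [← contMDiffAt_iff_contDiffAt, modelWithCornersSelf_prod, ← chartedSpaceSelf_prod]
    have h1 : ContMDiffAt (𝓡 n) (𝓡 n) ∞ d (F t y) :=
      (contMDiffOn_chart (I := 𝓡 n) (n := ∞) (x := F t y)).contMDiffAt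
        (d.open_source.mem_nhds (mem_chart_source _ (F t y)))
    have h2 := ContMDiffAt.comp (t, y) (g := d)
      (f := fun q : ℝ × EuclideanSpace ℝ (Fin m) => F q.1 q.2) h1 hF
    exact h2
  have hψ1 : ∀ᶠ q in nhds (t, y), ContDiffAt ℝ 1 ψ q :=
    (hψ.of_le (by norm_cast)).eventually (by simp)
  -- Composing with `inr` keeps the derivative in y only; t is a parameter.
  have hmain : ∀ᶠ q in nhds (t, y), pullbackGram (m := m) h (F q.1) q.2 =
      (coordMatrix ((fderiv ℝ ψ q).comp (ContinuousLinearMap.inr ℝ ℝ _))).transpose *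
        chartGram h (F t y) (ψ q) *
        coordMatrix ((fderiv ℝ ψ q).comp (ContinuousLinearMap.inr ℝ ℝ _)) := by
    filter_upwards [hsrc.eventually_nhds, hψ1] with q hq1 hq2
    have hpair : HasFDerivAt (fun z : EuclideanSpace ℝ (Fin m) => (q.1, z))
        (ContinuousLinearMap.inr ℝ ℝ (EuclideanSpace ℝ (Fin m))) q.2 := hasFDerivAt_prodMk_right _ _
    have hd1 : HasFDerivAt (fun z => ψ (q.1, z))
        ((fderiv ℝ ψ q).comp (ContinuousLinearMap.inr ℝ ℝ _)) q.2 :=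
      HasFDerivAt.comp q.2 (f := fun z : EuclideanSpace ℝ (Fin m) => (q.1, z)) (g := ψ)
        (hq2.differentiableAt (by simp)).hasFDerivAt hpair
    have hev : F q.1 =ᶠ[nhds q.2] d.symm ∘ fun z => ψ (q.1, z) := by
      have h2 := hpair.continuousAt.eventually hq1
      filter_upwards [h2] with z hz
      exact (d.left_inv hz).symm
    have htgt : ψ (q.1, q.2) ∈ d.target := d.map_source hq1.self_of_nhds
    rw [pullbackGram_congr h hev, pullbackGram_comp (ψ := fun z => ψ (q.1, z)) h
      (mdifferentiableAt_chart_symm (F t y) htgt) hd1.differentiableAt.mdifferentiableAt,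
      jacMatrix_eq_fderiv, hd1.fderiv]
    rfl
  refine ContDiffAt.congr_of_eventuallyEq ?_ (hmain.mono fun _ hq => congrFun (congrFun hq i) j)
  have hJ : ∀ k l, ContDiffAt ℝ ∞ (fun q => coordMatrix
      ((fderiv ℝ ψ q).comp (ContinuousLinearMap.inr ℝ ℝ (EuclideanSpace ℝ (Fin m)))) k l)
      (t, y) := by
    intro k l
    have h1 : ContDiffAt ℝ ∞ (fderiv ℝ ψ) (t, y) := hψ.fderiv_right (by simp)
    have h2 : ContDiffAt ℝ ∞ (fun q => fderiv ℝ ψ q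
      (0, (EuclideanSpace.single l (1 : ℝ) : EuclideanSpace ℝ (Fin m)))) (t, y) :=
      h1.clm_apply contDiffAt_const
    exact (contDiffAt_piLp 2).1 h2 k
  have hG : ∀ k l, ContDiffAt ℝ ∞ (fun q => chartGram h (F t y) (ψ q) k l) (t, y) := by
    intro k l
    have hmem : ψ (t, y) ∈ d.target := d.map_source (mem_chart_source _ (F t y))
    exact ((contDiffOn_chartGram h (F t y) k l).contDiffAt (d.open_target.mem_nhds hmem)).comp
      (t, y) hψ
  simp only [Matrix.mul_apply, Matrix.transpose_apply]
  exact ContDiffAt.sum fun k _ => (ContDiffAt.sum fun l _ => (hJ l i).mul (hG l k)).mul (hJ k j)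

section Variation

variable {φ : M → N} {Ω : Set M} {ε : ℝ} {Φ : ℝ → M → N}

lemma IsVariation.contMDiffAt (hΦ : IsVariation m n φ Ω ε Φ) {t : ℝ} (ht : t ∈ Ioo (-ε) ε)
    (x : M) : ContMDiffAt (𝓘(ℝ, ℝ).prod (𝓡 m)) (𝓡 n) ∞ (fun q : ℝ × M => Φ q.1 q.2) (t, x) :=
  hΦ.smooth.contMDiffAt ((isOpen_Ioo.prod isOpen_univ).mem_nhds ⟨ht, mem_univ x⟩)

lemma IsVariation.contMDiff_slice (hΦ : IsVariation m n φ Ω ε Φ) {t : ℝ} (ht : t ∈ Ioo (-ε) ε) :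
    ContMDiff (𝓡 m) (𝓡 n) ∞ (Φ t) := fun x =>
  ContMDiffAt.comp (f := fun z : M => (t, z)) x (hΦ.contMDiffAt ht x)
    (contMDiffAt_const.prodMk contMDiffAt_id)

lemma IsVariation.mdifferentiableAt (hΦ : IsVariation m n φ Ω ε Φ) {t : ℝ} (ht : t ∈ Ioo (-ε) ε)
    (x : M) : MDifferentiableAt (𝓡 m) (𝓡 n) (Φ t) x :=
  (hΦ.contMDiff_slice ht x).mdifferentiableAt (by simp)

lemma IsVariation.contDiffAt_pullbackGram_chart (hΦ : IsVariation m n φ Ω ε Φ) (h : RMetric n N)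
    {t : ℝ} (ht : t ∈ Ioo (-ε) ε) (x₀ : M) {y : EuclideanSpace ℝ (Fin m)}
    (hy : y ∈ (chartAt (EuclideanSpace ℝ (Fin m)) x₀).target) (i j : Fin m) :
    ContDiffAt ℝ ∞ (fun q : ℝ × EuclideanSpace ℝ (Fin m) => pullbackGram (m := m) h
      (Φ q.1 ∘ (chartAt (EuclideanSpace ℝ (Fin m)) x₀).symm) q.2 i j) (t, y) := by
  refine contDiffAt_pullbackGram h
    (F := fun t => Φ t ∘ (chartAt (EuclideanSpace ℝ (Fin m)) x₀).symm) ?_ i j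
  have h1 : ContMDiffAt (𝓡 m) (𝓡 m) ∞ (chartAt (EuclideanSpace ℝ (Fin m)) x₀).symm y :=
    contMDiffOn_chart_symm.contMDiffAt
      ((chartAt (EuclideanSpace ℝ (Fin m)) x₀).open_target.mem_nhds hy)
  exact ContMDiffAt.comp (g := fun q : ℝ × M => Φ q.1 q.2)
    (f := fun q : ℝ × EuclideanSpace ℝ (Fin m) =>
      (q.1, (chartAt (EuclideanSpace ℝ (Fin m)) x₀).symm q.2)) (t, y) (hΦ.contMDiffAt ht _)
    (contMDiffAt_fst.prodMk (ContMDiffAt.comp (t, y) h1 contMDiffAt_snd))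

lemma contDiffAt_chartGram_snd (g : RMetric m M) (t : ℝ) (x₀ : M) {y : EuclideanSpace ℝ (Fin m)}
    (hy : y ∈ (chartAt (EuclideanSpace ℝ (Fin m)) x₀).target) (i j : Fin m) :
    ContDiffAt ℝ ∞ (fun q : ℝ × EuclideanSpace ℝ (Fin m) => chartGram g x₀ q.2 i j) (t, y) :=
  ((contDiffOn_chartGram g x₀ i j).contDiffAt
    ((chartAt (EuclideanSpace ℝ (Fin m)) x₀).open_target.mem_nhds hy)).comp (t, y) contDiffAt_snd

lemma eventually_mem_Ioo_prod_target {ε t : ℝ} (ht : t ∈ Ioo (-ε) ε) (x₀ : M) {y : EuclideanSpace ℝ (Fin m)}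
    (hy : y ∈ (chartAt (EuclideanSpace ℝ (Fin m)) x₀).target) :
    ∀ᶠ q : ℝ × EuclideanSpace ℝ (Fin m) in nhds (t, y),
      q.1 ∈ Ioo (-ε) ε ∧ q.2 ∈ (chartAt (EuclideanSpace ℝ (Fin m)) x₀).target :=
  (isOpen_Ioo.prod (chartAt (EuclideanSpace ℝ (Fin m)) x₀).open_target).mem_nhds ⟨ht, hy⟩

lemma IsVariation.contDiffAt_normSqD (hΦ : IsVariation m n φ Ω ε Φ) (g : RMetric m M)
    (h : RMetric n N) {t : ℝ} (ht : t ∈ Ioo (-ε) ε) (x₀ : M) {y : EuclideanSpace ℝ (Fin m)}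
    (hy : y ∈ (chartAt (EuclideanSpace ℝ (Fin m)) x₀).target) :
    ContDiffAt ℝ ∞ (fun q : ℝ × EuclideanSpace ℝ (Fin m) => normSqD g h (Φ q.1)
      ((chartAt (EuclideanSpace ℝ (Fin m)) x₀).symm q.2)) (t, y) :=
  (contDiffAt_trace_inv_mul (contDiffAt_chartGram_snd g t x₀ hy)
    (hΦ.contDiffAt_pullbackGram_chart h ht x₀ hy) (det_chartGram_pos g x₀ hy).ne').congr_of_eventuallyEq
    ((eventually_mem_Ioo_prod_target ht x₀ hy).mono fun _ hq =>
      normSqD_chart g h x₀ hq.2 (hΦ.mdifferentiableAt hq.1 _))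

lemma IsVariation.contDiffAt_det_div_det (hΦ : IsVariation m n φ Ω ε Φ) (g : RMetric m M)
    (h : RMetric n N) {t : ℝ} (ht : t ∈ Ioo (-ε) ε) (x₀ : M) {y : EuclideanSpace ℝ (Fin m)}
    (hy : y ∈ (chartAt (EuclideanSpace ℝ (Fin m)) x₀).target) :
    ContDiffAt ℝ ∞ (fun q : ℝ × EuclideanSpace ℝ (Fin m) =>
      (pullbackGram (m := m) h (Φ q.1) ((chartAt (EuclideanSpace ℝ (Fin m)) x₀).symm q.2)).det /
        (metricGram g ((chartAt (EuclideanSpace ℝ (Fin m)) x₀).symm q.2)).det) (t, y) :=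
  ((contDiffAt_det (hΦ.contDiffAt_pullbackGram_chart h ht x₀ hy)).div
    (contDiffAt_det (contDiffAt_chartGram_snd g t x₀ hy))
    (det_chartGram_pos g x₀ hy).ne').congr_of_eventuallyEq
    ((eventually_mem_Ioo_prod_target ht x₀ hy).mono fun _ hq =>
      det_div_det_chart g h x₀ hq.2 (hΦ.mdifferentiableAt hq.1 _))

end Variation

end Smooth

/-! ### The Riemannian volume in charts -/

section Volume

set_option linter.unusedSectionVars false

variable {m : ℕ}
  {M : Type*} [TopologicalSpace M] [ChartedSpace (EuclideanSpace ℝ (Fin m)) M]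
  [IsManifold (𝓡 m) ∞ M]

lemma continuousOn_sqrt_det_chartGram (g : RMetric m M) (x₀ : M) :
    ContinuousOn (fun y => √((chartGram g x₀ y).det))
      (chartAt (EuclideanSpace ℝ (Fin m)) x₀).target := fun _ hy =>
  ((contDiffAt_det fun i j => (contDiffOn_chartGram g x₀ i j).contDiffAt
    ((chartAt (EuclideanSpace ℝ (Fin m)) x₀).open_target.mem_nhds hy)).continuousAt.sqrt
    ).continuousWithinAt

/-- Near y the second inverse chart is the first one composed with the transition map, whose
Jacobian therefore enters the Gram determinant squared. -/
lemma sqrt_det_chartGram_change (g : RMetric m M) (x₀ x₁ : M) {y : EuclideanSpace ℝ (Fin m)}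
    (hy : y ∈ (chartAt (EuclideanSpace ℝ (Fin m)) x₁).target)
    (hy' : (chartAt (EuclideanSpace ℝ (Fin m)) x₁).symm y ∈
      (chartAt (EuclideanSpace ℝ (Fin m)) x₀).source) :
    DifferentiableAt ℝ (chartAt (EuclideanSpace ℝ (Fin m)) x₀ ∘
      (chartAt (EuclideanSpace ℝ (Fin m)) x₁).symm) y ∧
    √((chartGram g x₁ y).det) = |(fderiv ℝ (chartAt (EuclideanSpace ℝ (Fin m)) x₀ ∘
      (chartAt (EuclideanSpace ℝ (Fin m)) x₁).symm) y).det| *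
      √((chartGram g x₀ (chartAt (EuclideanSpace ℝ (Fin m)) x₀
        ((chartAt (EuclideanSpace ℝ (Fin m)) x₁).symm y))).det) := by
  set c₀ := chartAt (EuclideanSpace ℝ (Fin m)) x₀ with hc₀
  set c₁ := chartAt (EuclideanSpace ℝ (Fin m)) x₁ with hc₁
  have hd : MDifferentiableAt (𝓡 m) (𝓡 m) (c₀ ∘ c₁.symm) y :=
    (mdifferentiableAt_atlas (chart_mem_atlas _ x₀) hy').comp y
      (mdifferentiableAt_chart_symm x₁ hy)
  refine ⟨mdifferentiableAt_iff_differentiableAt.1 hd, ?_⟩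
  have hev : c₁.symm =ᶠ[nhds y] c₀.symm ∘ (c₀ ∘ c₁.symm) := by
    filter_upwards [(c₁.symm.continuousAt hy).preimage_mem_nhds (c₀.open_source.mem_nhds hy')]
      with z hz
    exact (c₀.left_inv hz).symm
  have h1 : chartGram g x₁ y = _ := (pullbackGram_congr g hev).trans (pullbackGram_comp g
    (mdifferentiableAt_chart_symm x₀ (c₀.map_source hy')) hd)
  rw [h1, Matrix.det_mul, Matrix.det_mul, Matrix.det_transpose, jacMatrix_eq_fderiv,
    det_coordMatrix, mul_right_comm, ← sq, Real.sqrt_mul (sq_nonneg _), Real.sqrt_sq_eq_abs]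
  rfl

variable [MeasurableSpace M] [BorelSpace M]

lemma aemeasurable_chart_symm (x₀ : M) (μ : Measure (EuclideanSpace ℝ (Fin m))) :
    AEMeasurable (chartAt (EuclideanSpace ℝ (Fin m)) x₀).symm
      (μ.restrict (chartAt (EuclideanSpace ℝ (Fin m)) x₀).target) :=
  (chartAt (EuclideanSpace ℝ (Fin m)) x₀).continuousOn_symm.aemeasurable
    (chartAt (EuclideanSpace ℝ (Fin m)) x₀).open_target.measurableSet

lemma measurableSet_target_inter_preimage (x₀ : M) {A : Set M} (hA : MeasurableSet A) :
    MeasurableSet ((chartAt (EuclideanSpace ℝ (Fin m)) x₀).target ∩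
      (chartAt (EuclideanSpace ℝ (Fin m)) x₀).symm ⁻¹' A) := by
  set c := chartAt (EuclideanSpace ℝ (Fin m)) x₀
  have h1 : Measurable (c.target.domRestrict c.symm) := c.continuousOn_symm.domRestrict.measurable
  have h2 := c.open_target.measurableSet.subtype_image (h1 hA)
  convert h2 using 1
  ext y
  exact ⟨fun ⟨a, b⟩ => ⟨⟨y, a⟩, b, rfl⟩, by rintro ⟨⟨y, a⟩, b, rfl⟩; exact ⟨a, b⟩⟩

lemma chartVolume_apply (g : RMetric m M) (x₀ : M) {A : Set M} (hA : MeasurableSet A) :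
    chartVolume g x₀ A = ∫⁻ y in (chartAt (EuclideanSpace ℝ (Fin m)) x₀).target ∩
      (chartAt (EuclideanSpace ℝ (Fin m)) x₀).symm ⁻¹' A,
        ENNReal.ofReal √((chartGram g x₀ y).det) := by
  rw [chartVolume, Measure.map_apply_of_aemeasurable (aemeasurable_chart_symm x₀ _) hA,
    Measure.restrict_apply' (chartAt (EuclideanSpace ℝ (Fin m)) x₀).open_target.measurableSet,
    inter_comm, withDensity_apply _ (measurableSet_target_inter_preimage x₀ hA)]

/-- Change of variables along the transition map. Only an inequality results, since A may leave the
domain of the chart at x₁. -/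
lemma chartVolume_le (g : RMetric m M) (x₀ x₁ : M) {A : Set M} (hA : MeasurableSet A)
    (hAs : A ⊆ (chartAt (EuclideanSpace ℝ (Fin m)) x₀).source) :
    chartVolume g x₁ A ≤ chartVolume g x₀ A := by
  rw [chartVolume_apply g x₁ hA, chartVolume_apply g x₀ hA]
  set c₀ := chartAt (EuclideanSpace ℝ (Fin m)) x₀ with hc₀
  set c₁ := chartAt (EuclideanSpace ℝ (Fin m)) x₁ with hc₁
  have hS := measurableSet_target_inter_preimage (m := m) x₁ hA
  have hch : ∀ y ∈ c₁.target ∩ c₁.symm ⁻¹' A, _ := fun y hy =>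
    sqrt_det_chartGram_change g x₀ x₁ hy.1 (hAs hy.2)
  calc ∫⁻ y in c₁.target ∩ c₁.symm ⁻¹' A, ENNReal.ofReal √((chartGram g x₁ y).det)
      = ∫⁻ y in c₁.target ∩ c₁.symm ⁻¹' A,
          ENNReal.ofReal |(fderiv ℝ (c₀ ∘ c₁.symm) y).det| *
            ENNReal.ofReal √((chartGram g x₀ ((c₀ ∘ c₁.symm) y)).det) := by
        refine setLIntegral_congr_fun hS fun y hy => ?_
        rw [(hch y hy).2, ENNReal.ofReal_mul (abs_nonneg _)]
        rfl
    _ = ∫⁻ y in (c₀ ∘ c₁.symm) '' (c₁.target ∩ c₁.symm ⁻¹' A),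
          ENNReal.ofReal √((chartGram g x₀ y).det) := by
        refine (lintegral_image_eq_lintegral_abs_det_fderiv_mul volume hS
          (fun y hy => (hch y hy).1.hasFDerivAt.hasFDerivWithinAt) ?_
          (fun y => ENNReal.ofReal √((chartGram g x₀ y).det))).symm
        exact (c₀.injOn.mono hAs).comp (c₁.symm.injOn.mono inter_subset_left) fun y hy => hy.2
    _ ≤ _ := by
        refine lintegral_mono_set ?_
        rintro _ ⟨y, hy, rfl⟩
        exact ⟨c₀.map_source (hAs hy.2), by
          simpa [c₀.left_inv (hAs hy.2)] using hy.2⟩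

lemma riemannianVolume_restrict_source (g : RMetric m M) (x₀ : M) :
    (riemannianVolume g).restrict (chartAt (EuclideanSpace ℝ (Fin m)) x₀).source =
      chartVolume g x₀ := by
  set s := (chartAt (EuclideanSpace ℝ (Fin m)) x₀).source with hs
  have hsm : MeasurableSet s := (chartAt (EuclideanSpace ℝ (Fin m)) x₀).open_source.measurableSet
  have h0 : (chartVolume g x₀).restrict s = chartVolume g x₀ := by
    rw [Measure.restrict_eq_self_of_ae_mem]
    rw [ae_iff]
    change chartVolume g x₀ sᶜ = 0
    rw [chartVolume_apply g x₀ hsm.compl]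
    convert setLIntegral_empty _
    ext y
    simp only [mem_inter_iff, mem_preimage, mem_compl_iff, mem_empty_iff_false, iff_false, not_and,
      not_not]
    exact fun hy => (chartAt (EuclideanSpace ℝ (Fin m)) x₀).map_target hy
  refine le_antisymm ?_ ?_
  -- Off the chart domain the crude bound ⊤ suffices: restricting to s removes it.
  · have h1 : riemannianVolume g ≤ chartVolume g x₀ + (⊤ : Measure M).restrict sᶜ := by
      refine iSup_le fun x₁ => ?_
      rw [← Measure.restrict_add_restrict_compl (μ := chartVolume g x₁) hsm]
      refine add_le_add ?_ (Measure.restrict_mono_measure le_top _)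
      refine Measure.le_iff.2 fun A hA => ?_
      rw [Measure.restrict_apply hA]
      exact (chartVolume_le g x₀ x₁ (hA.inter hsm) inter_subset_right).trans
        (measure_mono inter_subset_left)
    refine (Measure.restrict_mono_measure h1 s).trans ?_
    rw [Measure.restrict_add, Measure.restrict_restrict hsm, inter_compl_self,
      Measure.restrict_empty, add_zero]
    exact Measure.restrict_le_self
  · rw [← h0]
    exact Measure.restrict_mono_measure (le_iSup (fun x => chartVolume g x) x₀) s

instance isFiniteMeasureOnCompacts_riemannianVolume [T2Space M] (g : RMetric m M) :
    IsFiniteMeasureOnCompacts (riemannianVolume g) := by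
  have : IsLocallyFiniteMeasure (riemannianVolume g) := by
    refine ⟨fun x => ?_⟩
    set c := chartAt (EuclideanSpace ℝ (Fin m)) x with hc
    obtain ⟨r, hr, hball⟩ := Metric.nhds_basis_closedBall.mem_iff.1
      (c.open_target.mem_nhds (mem_chart_target _ x))
    have hA : IsOpen (c.source ∩ c ⁻¹' Metric.ball (c x) r) :=
      c.isOpen_inter_preimage Metric.isOpen_ball
    refine ⟨_, hA.mem_nhds ⟨mem_chart_source _ x, Metric.mem_ball_self hr⟩, ?_⟩
    rw [← Measure.restrict_eq_self _ inter_subset_left, riemannianVolume_restrict_source,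
      chartVolume_apply g x hA.measurableSet]
    have hK : IsCompact (Metric.closedBall (c x) r) := isCompact_closedBall _ _
    have hint : IntegrableOn (fun y => √((chartGram g x y).det)) (Metric.closedBall (c x) r) :=
      ((continuousOn_sqrt_det_chartGram g x).mono hball).integrableOn_compact hK
    refine lt_of_le_of_lt (lintegral_mono_set ?_) hint.lintegral_lt_top
    rintro y ⟨hy, -, hy'⟩
    have : c (c.symm y) ∈ Metric.ball (c x) r := hy'
    rw [c.right_inv hy] at this
    exact Metric.ball_subset_closedBall this
  infer_instance

lemma setIntegral_source_riemannianVolume (g : RMetric m M) (x₀ : M) {F : M → ℝ}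
    (hF : Measurable F) :
    ∫ x in (chartAt (EuclideanSpace ℝ (Fin m)) x₀).source, F x ∂(riemannianVolume g) =
      ∫ y in (chartAt (EuclideanSpace ℝ (Fin m)) x₀).target,
        √((chartGram g x₀ y).det) * F ((chartAt (EuclideanSpace ℝ (Fin m)) x₀).symm y) := by
  rw [riemannianVolume_restrict_source, chartVolume,
    integral_map (aemeasurable_chart_symm x₀ _) hF.aestronglyMeasurable,
    restrict_withDensity (chartAt (EuclideanSpace ℝ (Fin m)) x₀).open_target.measurableSet,
    integral_withDensity_eq_integral_toReal_smul₀]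
  · simp [ENNReal.toReal_ofReal]
  · exact ((continuousOn_sqrt_det_chartGram g x₀).aemeasurable
      (chartAt (EuclideanSpace ℝ (Fin m)) x₀).open_target.measurableSet).ennreal_ofReal
  · exact Filter.Eventually.of_forall fun _ => ENNReal.ofReal_lt_top

end Volume

/-! ### The derivative of the determinant at a scalar matrix -/

lemma hasDerivAt_det_of_eq_one {m : ℕ} {A : ℝ → Matrix (Fin m) (Fin m) ℝ}
    {A' : Matrix (Fin m) (Fin m) ℝ} {t : ℝ}
    (hA : ∀ i j, HasDerivAt (fun s => A s i j) (A' i j) t) (h1 : A t = 1) :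
    HasDerivAt (fun s => (A s).det) A'.trace t := by
  simp only [Matrix.det_apply']
  have h2 := HasDerivAt.fun_sum (u := Finset.univ) fun (σ : Equiv.Perm (Fin m)) _ =>
    (HasDerivAt.fun_finsetProd (u := Finset.univ) fun i _ => hA (σ i) i).const_mul
      ((Equiv.Perm.sign σ : ℤ) : ℝ)
  refine h2.congr_deriv (Eq.symm ?_)
  rw [Finset.sum_eq_single (1 : Equiv.Perm (Fin m))]
  · simp [Matrix.trace, h1, Finset.prod_eq_one]
  · intro σ _ hσ
    rw [Finset.sum_eq_zero, mul_zero]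
    intro i _
    -- A permutation other than the identity moves at least two indices, so after the factor i is
    -- differentiated an off-diagonal entry of the identity matrix remains and kills the product.
    obtain ⟨j, hj⟩ : ∃ j, j ≠ i ∧ σ j ≠ j := by
      by_contra! hcon
      refine hσ (Equiv.ext fun k => ?_)
      by_cases hk : k = i
      · subst hk
        by_contra hne
        have := hcon (σ k) hne
        exact hne (σ.injective this)
      · exact hcon k hk
    rw [Finset.prod_eq_zero (i := j) (by simp [hj.1]) (by rw [h1, Matrix.one_apply_ne hj.2]),
      zero_smul]
  · simp

lemma hasDerivAt_det_of_eq_smul_one {m : ℕ} {A : ℝ → Matrix (Fin m) (Fin m) ℝ}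
    {A' : Matrix (Fin m) (Fin m) ℝ} {t c : ℝ} (hc : c ≠ 0)
    (hA : ∀ i j, HasDerivAt (fun s => A s i j) (A' i j) t) (h1 : A t = c • 1) :
    HasDerivAt (fun s => (A s).det) (c ^ m * c⁻¹ * A'.trace) t := by
  have h2 := (hasDerivAt_det_of_eq_one (A := fun s => c⁻¹ • A s) (A' := c⁻¹ • A') (t := t)
    (fun i j => (hA i j).const_mul c⁻¹) (by simp [h1, hc])).const_mul (c ^ m)
  refine (h2.congr_deriv ?_).congr_of_eventuallyEq (Filter.Eventually.of_forall fun s => ?_)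
  · rw [Matrix.trace_smul, smul_eq_mul, mul_assoc]
  · beta_reduce
    rw [Matrix.det_smul, Fintype.card_fin, ← mul_assoc, ← mul_pow, mul_inv_cancel₀ hc, one_pow,
      one_mul]

/-! ### Differentiation under the integral over a compact set -/

section Param

set_option linter.unusedSectionVars false

variable {m : ℕ}
  {M : Type*} [TopologicalSpace M] [ChartedSpace (EuclideanSpace ℝ (Fin m)) M]
  [IsManifold (𝓡 m) ∞ M]

/-- Supplies the local domination and measurability data; compactness makes the bound uniform over Ω
in `hasDerivAt_setIntegral_of_contDiffAt`. -/
lemma exists_nhds_deriv_bound {F : ℝ → M → ℝ} {x : M}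
    (hF : ContDiffAt ℝ 1 (fun q : ℝ × EuclideanSpace ℝ (Fin m) => F q.1
      ((chartAt (EuclideanSpace ℝ (Fin m)) x).symm q.2))
      (0, chartAt (EuclideanSpace ℝ (Fin m)) x x)) :
    ∃ V ∈ nhds x, ∃ δ > 0, ∃ C : ℝ, ∀ t ∈ Ioo (-δ) δ, ∀ z ∈ V,
      DifferentiableAt ℝ (fun s => F s z) t ∧ |deriv (fun s => F s z) t| ≤ C ∧
      ContinuousAt (F t) z ∧ ContinuousAt (fun z => deriv (fun s => F s z) t) z := by
  set c := chartAt (EuclideanSpace ℝ (Fin m)) x with hc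
  set G : ℝ × EuclideanSpace ℝ (Fin m) → ℝ := fun q => F q.1 (c.symm q.2) with hG
  have h1 : ∀ᶠ q in nhds ((0 : ℝ), c x), ContDiffAt ℝ 1 G q := hF.eventually (by simp)
  have hcont : ContinuousAt (fun q => |fderiv ℝ G q (1, 0)|) ((0 : ℝ), c x) :=
    (((hF.fderiv_right (m := 0) (by simp)).continuousAt).clm_apply continuousAt_const).abs
  have h2 : ∀ᶠ q in nhds ((0 : ℝ), c x), |fderiv ℝ G q (1, 0)| <
      |fderiv ℝ G (0, c x) (1, 0)| + 1 := hcont.eventually_lt_const (lt_add_one _)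
  have h3 := h1.and h2
  rw [nhds_prod_eq] at h3
  obtain ⟨pa, ha, pb, hb, hab⟩ := Filter.eventually_prod_iff.1 h3
  obtain ⟨δ, hδ, hball⟩ := Metric.mem_nhds_iff.1 ha
  have hxs : x ∈ c.source := mem_chart_source _ x
  -- The neighbourhood is taken open so that the formula for the derivative holds around each of its
  -- points, which continuity in z requires.
  refine ⟨interior {z | z ∈ c.source ∧ pb (c z)}, ?_, δ, hδ,
    |fderiv ℝ G (0, c x) (1, 0)| + 1, fun t ht z hz => ?_⟩
  · exact interior_mem_nhds.2 (Filter.inter_mem (c.open_source.mem_nhds hxs)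
      ((c.continuousAt hxs).eventually hb))
  · have hz' := interior_subset hz
    have hpa : pa t := hball (by simpa [Real.ball_eq_Ioo] using ht)
    have hder : ∀ z ∈ interior {z | z ∈ c.source ∧ pb (c z)},
        HasDerivAt (fun s => F s z) (fderiv ℝ G (t, c z) (1, 0)) t := by
      intro z hz
      have hz' := interior_subset hz
      have h4 : HasDerivAt (fun s : ℝ => (s, c z)) ((1 : ℝ), (0 : EuclideanSpace ℝ (Fin m))) t :=
        (hasDerivAt_id t).prodMk (hasDerivAt_const t (c z))
      have h5 := ((hab hpa hz'.2).1.differentiableAt (by simp)).hasFDerivAt.comp_hasDerivAt t h4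
      refine h5.congr_of_eventuallyEq (Filter.Eventually.of_forall fun s => ?_)
      simp only [hG, Function.comp, c.left_inv hz'.1]
    have hzc : ContinuousAt (fun z : M => (t, c z)) z :=
      continuousAt_const.prodMk (c.continuousAt hz'.1)
    refine ⟨(hder z hz).differentiableAt, ?_, ?_, ?_⟩
    · rw [(hder z hz).deriv]
      exact (hab hpa hz'.2).2.le
    · refine ContinuousAt.congr (f := fun z => G (t, c z)) ?_ ?_
      · exact ContinuousAt.comp (g := G) (f := fun z : M => (t, c z)) (hab hpa hz'.2).1.continuousAt hzc
      · filter_upwards [c.open_source.mem_nhds hz'.1] with w hw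
        simp only [hG, c.left_inv hw]
    · refine ContinuousAt.congr (f := fun z => fderiv ℝ G (t, c z) (1, 0)) ?_ ?_
      · have h6 : ContinuousAt (fderiv ℝ G) (t, c z) :=
          ((hab hpa hz'.2).1.fderiv_right (m := 0) (by simp)).continuousAt
        exact (ContinuousAt.comp (g := fderiv ℝ G) (f := fun z : M => (t, c z)) h6 hzc).clm_apply
          continuousAt_const
      · filter_upwards [isOpen_interior.mem_nhds hz] with w hw
        exact (hder w hw).deriv.symm

lemma hasDerivAt_setIntegral_of_contDiffAt [SecondCountableTopology M] [T2Space M]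
    [MeasurableSpace M] [BorelSpace M]
    {μ : Measure M} [IsFiniteMeasureOnCompacts μ] {Ω : Set M} (hΩ : IsCompact Ω) {F : ℝ → M → ℝ}
    (hF : ∀ x, ContDiffAt ℝ 1 (fun q : ℝ × EuclideanSpace ℝ (Fin m) => F q.1
      ((chartAt (EuclideanSpace ℝ (Fin m)) x).symm q.2))
      (0, chartAt (EuclideanSpace ℝ (Fin m)) x x)) :
    HasDerivAt (fun t => ∫ x in Ω, F t x ∂μ) (∫ x in Ω, deriv (fun t => F t x) 0 ∂μ) 0 := by
  obtain ⟨δ, hδ, C, hC⟩ : ∃ δ > 0, ∃ C : ℝ, ∀ t ∈ Ioo (-δ) δ, ∀ z ∈ Ω,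
      DifferentiableAt ℝ (fun s => F s z) t ∧ |deriv (fun s => F s z) t| ≤ C ∧
      ContinuousAt (F t) z ∧ ContinuousAt (fun z => deriv (fun s => F s z) t) z := by
    refine hΩ.induction_on (p := fun V => ∃ δ > 0, ∃ C : ℝ, ∀ t ∈ Ioo (-δ) δ, ∀ z ∈ V,
      DifferentiableAt ℝ (fun s => F s z) t ∧ |deriv (fun s => F s z) t| ≤ C ∧
      ContinuousAt (F t) z ∧ ContinuousAt (fun z => deriv (fun s => F s z) t) z) ?_ ?_ ?_ ?_
    · exact ⟨1, one_pos, 0, by simp⟩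
    · rintro s t hst ⟨δ, hδ, C, hC⟩
      exact ⟨δ, hδ, C, fun a ha z hz => hC a ha z (hst hz)⟩
    · rintro s t ⟨δ, hδ, C, hC⟩ ⟨δ', hδ', C', hC'⟩
      refine ⟨min δ δ', lt_min hδ hδ', max C C', fun a ha z hz => ?_⟩
      rcases hz with hz | hz
      · obtain ⟨h1, h2, h3⟩ := hC a ⟨(neg_le_neg (min_le_left _ _)).trans_lt ha.1,
          ha.2.trans_le (min_le_left _ _)⟩ z hz
        exact ⟨h1, h2.trans (le_max_left _ _), h3⟩
      · obtain ⟨h1, h2, h3⟩ := hC' a ⟨(neg_le_neg (min_le_right _ _)).trans_lt ha.1,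
          ha.2.trans_le (min_le_right _ _)⟩ z hz
        exact ⟨h1, h2.trans (le_max_right _ _), h3⟩
    · intro x _
      obtain ⟨V, hV, h⟩ := exists_nhds_deriv_bound (hF x)
      exact ⟨V, mem_nhdsWithin_of_mem_nhds hV, h⟩
  have h0 : (0 : ℝ) ∈ Ioo (-δ) δ := ⟨by linarith, hδ⟩
  have hnhds : Ioo (-δ) δ ∈ nhds (0 : ℝ) := isOpen_Ioo.mem_nhds h0
  have hΩm := hΩ.measurableSet
  refine (hasDerivAt_integral_of_dominated_loc_of_deriv_le (bound := fun _ => C)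
    (F' := fun t x => deriv (fun s => F s x) t) hnhds ?_ ?_ ?_ ?_ ?_ ?_).2
  · filter_upwards [hnhds] with t ht
    exact ContinuousOn.aestronglyMeasurable
      (fun z hz => (hC t ht z hz).2.2.1.continuousWithinAt) hΩm
  · exact ContinuousOn.integrableOn_compact hΩ
      (fun z hz => (hC 0 h0 z hz).2.2.1.continuousWithinAt)
  · exact ContinuousOn.aestronglyMeasurable
      (fun z hz => (hC 0 h0 z hz).2.2.2.continuousWithinAt) hΩm
  · filter_upwards [ae_restrict_mem hΩm] with z hz t ht
    exact (hC t ht z hz).2.1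
  · exact integrableOn_const hΩ.measure_lt_top.ne
  · filter_upwards [ae_restrict_mem hΩm] with z hz t ht
    exact (hC t ht z hz).1.hasDerivAt

end Param

/-! ### First variation of the densities at a conformal immersion -/

section FirstVariation

set_option linter.unusedSectionVars false

variable {m n : ℕ}
  {M : Type*} [TopologicalSpace M] [ChartedSpace (EuclideanSpace ℝ (Fin m)) M]
  [IsManifold (𝓡 m) ∞ M]
  {N : Type*} [TopologicalSpace N] [ChartedSpace (EuclideanSpace ℝ (Fin n)) N]
  [IsManifold (𝓡 n) ∞ N]
  {g : RMetric m M} {h : RMetric n N} {φ : M → N} {lam : M → ℝ} {Ω : Set M} {ε : ℝ}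
  {Φ : ℝ → M → N}

lemma IsVariation.zero_mem (hΦ : IsVariation m n φ Ω ε Φ) : (0 : ℝ) ∈ Ioo (-ε) ε :=
  ⟨neg_neg_iff_pos.2 hΦ.pos, hΦ.pos⟩

variable (g h) in
/-- The derivative at `t = 0` of the energy density `|dΦ_t|²`. -/
def normSqVariation (Φ : ℝ → M → N) (x : M) : ℝ := deriv (fun t => normSqD g h (Φ t) x) 0

lemma IsConformalImmersion.pullbackGram_eq (hφ : IsConformalImmersion g h φ lam) (x : M) :
    pullbackGram h φ x = lam x ^ 2 • metricGram g x := by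
  ext i j
  exact hφ.pullback x _ _

lemma IsConformalImmersion.normSqD_eq (hφ : IsConformalImmersion g h φ lam) (x : M) :
    normSqD g h φ x = m * lam x ^ 2 := by
  unfold normSqD
  rw [hφ.pullbackGram_eq, Matrix.mul_smul,
    Matrix.nonsing_inv_mul _ (isUnit_iff_ne_zero.2 (metricGram_posDef g x).det_pos.ne')]
  simp [mul_comm]

lemma IsConformalImmersion.det_div_det_eq (hφ : IsConformalImmersion g h φ lam) (x : M) :
    (pullbackGram (m := m) h φ x).det / (metricGram g x).det = (lam x ^ m) ^ 2 := by
  rw [hφ.pullbackGram_eq, Matrix.det_smul, mul_div_assoc,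
    div_self (metricGram_posDef g x).det_pos.ne', Fintype.card_fin, mul_one, ← pow_mul, ← pow_mul,
    mul_comm]

lemma IsConformalImmersion.mdifferentiableAt (hφ : IsConformalImmersion g h φ lam) (x : M) :
    MDifferentiableAt (𝓡 m) (𝓡 n) φ x := (hφ.smooth x).mdifferentiableAt (by simp)

lemma IsVariation.hasDerivAt_normSqD (hΦ : IsVariation m n φ Ω ε Φ) (x : M) :
    HasDerivAt (fun t => normSqD g h (Φ t) x) (normSqVariation g h Φ x) 0 := by
  have h1 := (hΦ.contDiffAt_normSqD g h hΦ.zero_mem x (mem_chart_target _ x)).of_le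
    (m := 1) (by norm_cast)
  obtain ⟨V, hV, δ, hδ, C, hC⟩ := exists_nhds_deriv_bound
    (F := fun t x => normSqD g h (Φ t) x) h1
  exact (hC 0 ⟨by linarith, hδ⟩ x (mem_of_mem_nhds hV)).1.hasDerivAt

lemma IsVariation.continuous_normSqVariation (hΦ : IsVariation m n φ Ω ε Φ) :
    Continuous (normSqVariation g h Φ) := by
  refine continuous_iff_continuousAt.2 fun x => ?_
  have h1 := (hΦ.contDiffAt_normSqD g h hΦ.zero_mem x (mem_chart_target _ x)).of_le
    (m := 1) (by norm_cast)
  obtain ⟨V, hV, δ, hδ, C, hC⟩ := exists_nhds_deriv_bound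
    (F := fun t x => normSqD g h (Φ t) x) h1
  exact (hC 0 ⟨by linarith, hδ⟩ x (mem_of_mem_nhds hV)).2.2.2

lemma IsVariation.hasDerivAt_det_div_det (hΦ : IsVariation m n φ Ω ε Φ)
    (hφ : IsConformalImmersion g h φ lam) (x : M) :
    HasDerivAt (fun t => (pullbackGram (m := m) h (Φ t) x).det / (metricGram g x).det)
      ((lam x ^ 2) ^ m * (lam x ^ 2)⁻¹ * normSqVariation g h Φ x) 0 := by
  set c := chartAt (EuclideanSpace ℝ (Fin m)) x with hc
  have hy : c x ∈ c.target := mem_chart_target _ x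
  have hcx : c.symm (c x) = x := c.left_inv (mem_chart_source _ x)
  -- Both densities are invariants of this one matrix: its trace is |dΦ_t|², its determinant the
  -- squared Jacobian, and it is λ²·1 at t = 0.
  let A : ℝ → Matrix (Fin m) (Fin m) ℝ := fun t =>
    (chartGram g x (c x))⁻¹ * pullbackGram (m := m) h (Φ t ∘ c.symm) (c x)
  have hdet := (det_chartGram_pos g x hy).ne'
  have hP : ∀ i j, DifferentiableAt ℝ
      (fun t => pullbackGram (m := m) h (Φ t ∘ c.symm) (c x) i j) 0 := fun i j =>
    DifferentiableAt.comp (f := fun t : ℝ => (t, c x)) (g := fun q : ℝ × EuclideanSpace ℝ (Fin m) =>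
        pullbackGram (m := m) h (Φ q.1 ∘ c.symm) q.2 i j) 0
      ((hΦ.contDiffAt_pullbackGram_chart h hΦ.zero_mem x hy i j).differentiableAt (by simp))
      (differentiableAt_id.prodMk (differentiableAt_const _))
  have hAd : ∀ i j, DifferentiableAt ℝ (fun t => A t i j) 0 := fun i j => by
    simp only [A, Matrix.mul_apply]
    exact DifferentiableAt.fun_sum fun k _ => (hP k j).const_mul _
  have hA0 : A 0 = lam x ^ 2 • 1 := by
    have hφx := hφ.mdifferentiableAt (c.symm (c x))
    simp only [A, hΦ.zero]
    rw [pullbackGram_comp h hφx (mdifferentiableAt_chart_symm x hy), hφ.pullbackGram_eq,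
      Matrix.mul_smul, Matrix.smul_mul, ← chartGram_eq g x hy, Matrix.mul_smul,
      Matrix.nonsing_inv_mul _ (isUnit_iff_ne_zero.2 hdet), hcx]
  have hnear : ∀ᶠ t in nhds (0 : ℝ), t ∈ Ioo (-ε) ε := isOpen_Ioo.mem_nhds hΦ.zero_mem
  have htr : (fun t => normSqD g h (Φ t) x) =ᶠ[nhds 0] fun t => (A t).trace := by
    filter_upwards [hnear] with t ht
    have := normSqD_chart g h x hy (hΦ.mdifferentiableAt ht _)
    rwa [hcx] at this
  have hdt : (fun t => (pullbackGram (m := m) h (Φ t) x).det / (metricGram g x).det)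
      =ᶠ[nhds 0] fun t => (A t).det := by
    filter_upwards [hnear] with t ht
    have := det_div_det_chart g h x hy (hΦ.mdifferentiableAt ht _)
    rw [hcx] at this
    simp only [A, Matrix.det_mul, Matrix.det_nonsing_inv, Ring.inverse_eq_inv]
    rw [this, div_eq_inv_mul]
  have h1 := hasDerivAt_det_of_eq_smul_one (A' := Matrix.of fun i j => deriv (fun t => A t i j) 0)
    (pow_ne_zero 2 (hφ.pos x).ne') (fun i j => (hAd i j).hasDerivAt) hA0
  refine (h1.congr_of_eventuallyEq hdt).congr_deriv ?_
  congr 1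
  refine HasDerivAt.unique ?_ (hΦ.hasDerivAt_normSqD (g := g) (h := h) x)
  refine HasDerivAt.congr_of_eventuallyEq ?_ htr
  simp only [Matrix.trace, Matrix.diag_apply, Matrix.of_apply]
  exact HasDerivAt.fun_sum fun i _ => (hAd i i).hasDerivAt

lemma IsVariation.hasDerivAt_jacobianD (hΦ : IsVariation m n φ Ω ε Φ)
    (hφ : IsConformalImmersion g h φ lam) (x : M) :
    HasDerivAt (fun t => jacobianD g h (Φ t) x)
      (1 / 2 * (lam x ^ ((m : ℤ) - 2) * normSqVariation g h Φ x)) 0 := by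
  have hl := hφ.pos x
  have h0 : (pullbackGram (m := m) h (Φ 0) x).det / (metricGram g x).det = (lam x ^ m) ^ 2 := by
    rw [hΦ.zero, hφ.det_div_det_eq]
  have h1 := (hΦ.hasDerivAt_det_div_det hφ x).sqrt (by rw [h0]; positivity)
  -- The derivative of the square root is (λ²)^(m-1) e' / (2λ^m).
  refine h1.congr_deriv ?_
  rw [h0, Real.sqrt_sq (by positivity), zpow_sub₀ hl.ne', zpow_natCast]
  norm_cast
  rw [pow_right_comm]
  field_simp

lemma IsVariation.hasDerivAt_pDensity (hΦ : IsVariation m n φ Ω ε Φ)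
    (hφ : IsConformalImmersion g h φ lam) (hm : m ≠ 0) (x : M) :
    HasDerivAt (fun t => (√(normSqD g h (Φ t) x)) ^ (m : ℝ))
      (m / 2 * √m ^ ((m : ℤ) - 2) * (lam x ^ ((m : ℤ) - 2) * normSqVariation g h Φ x)) 0 := by
  have hl := hφ.pos x
  have hm0 : (0 : ℝ) < m := by positivity
  have h0 : normSqD g h (Φ 0) x = m * lam x ^ 2 := by rw [hΦ.zero, hφ.normSqD_eq]
  have hs : √(m * lam x ^ 2) = √m * lam x := by rw [Real.sqrt_mul hm0.le, Real.sqrt_sq hl.le]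
  have h1 := ((hΦ.hasDerivAt_normSqD (g := g) (h := h) x).sqrt (by rw [h0]; positivity)).pow m
  simp only [Real.rpow_natCast]
  refine h1.congr_deriv ?_
  have hsm : √(m : ℝ) ≠ 0 := by positivity
  -- The power rule leaves the natural exponent m - 1, not truncated as m ≠ 0; dividing by a yields
  -- the integer exponent m - 2, which may be negative.
  have hz : ∀ a : ℝ, a ≠ 0 → a ^ ((m : ℤ) - 2) = a ^ (m - 1) / a := by
    intro a ha
    obtain ⟨k, rfl⟩ := Nat.exists_eq_succ_of_ne_zero hm
    rw [show ((k.succ : ℕ) : ℤ) - 2 = k - 1 by push_cast; ring, zpow_sub_one₀ ha, zpow_natCast]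
    rfl
  rw [h0, hs, hz _ hsm, hz _ hl.ne', mul_pow]
  field_simp

end FirstVariation

/-! ### Criticality as vanishing of a weighted first variation -/

section CriticalPoints

set_option linter.unusedSectionVars false

variable {m n : ℕ}
  {M : Type*} [TopologicalSpace M] [T2Space M] [SecondCountableTopology M]
  [ChartedSpace (EuclideanSpace ℝ (Fin m)) M]
  [IsManifold (𝓡 m) ∞ M] [MeasurableSpace M] [BorelSpace M]
  {N : Type*} [TopologicalSpace N] [ChartedSpace (EuclideanSpace ℝ (Fin n)) N]
  [IsManifold (𝓡 n) ∞ N]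
  {g : RMetric m M} {h : RMetric n N} {φ : M → N} {lam : M → ℝ} {Ω : Set M} {ε : ℝ}
  {Φ : ℝ → M → N} {f : M → ℝ}

lemma IsVariation.hasDerivAt_fEnergy (hΦ : IsVariation m n φ Ω ε Φ) (hΩ : IsCompact Ω)
    (hf : ContMDiff (𝓡 m) 𝓘(ℝ, ℝ) ∞ f) :
    HasDerivAt (fun t => fEnergy g h f Ω (Φ t))
      (1 / 2 * ∫ x in Ω, f x * normSqVariation g h Φ x ∂(riemannianVolume g)) 0 := by
  have h1 := (hasDerivAt_setIntegral_of_contDiffAt (μ := riemannianVolume g) hΩ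
    (F := fun t x => f x * normSqD g h (Φ t) x) fun x =>
      ((ContDiffAt.comp (0, chartAt (EuclideanSpace ℝ (Fin m)) x x)
        (contDiffAt_comp_chart_symm hf x (mem_chart_target _ x)) contDiffAt_snd).mul
        (hΦ.contDiffAt_normSqD g h hΦ.zero_mem x (mem_chart_target _ x))).of_le
        (by norm_cast)).const_mul (1 / 2)
  refine h1.congr_deriv ?_
  congr 1
  exact setIntegral_congr_fun hΩ.measurableSet fun x _ =>
    ((hΦ.hasDerivAt_normSqD x).const_mul (f x)).deriv

lemma IsVariation.hasDerivAt_volumeFunctional (hΦ : IsVariation m n φ Ω ε Φ) (hΩ : IsCompact Ω)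
    (hφ : IsConformalImmersion g h φ lam) :
    HasDerivAt (fun t => volumeFunctional g h Ω (Φ t))
      (1 / 2 * ∫ x in Ω, lam x ^ ((m : ℤ) - 2) * normSqVariation g h Φ x ∂(riemannianVolume g))
      0 := by
  have h1 := hasDerivAt_setIntegral_of_contDiffAt (μ := riemannianVolume g) hΩ
    (F := fun t x => jacobianD g h (Φ t) x) fun x => by
      refine ((hΦ.contDiffAt_det_div_det g h hΦ.zero_mem x (mem_chart_target _ x)).sqrt ?_).of_le
        (by norm_cast)
      simp only
      rw [hΦ.zero, hφ.det_div_det_eq]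
      exact pow_ne_zero _ (pow_ne_zero _ (hφ.pos _).ne')
  refine h1.congr_deriv ?_
  rw [← integral_const_mul]
  exact setIntegral_congr_fun hΩ.measurableSet fun x _ => (hΦ.hasDerivAt_jacobianD hφ x).deriv

lemma IsVariation.hasDerivAt_pEnergy (hΦ : IsVariation m n φ Ω ε Φ) (hΩ : IsCompact Ω)
    (hφ : IsConformalImmersion g h φ lam) (hm : m ≠ 0) :
    HasDerivAt (fun t => pEnergy g h m Ω (Φ t))
      (1 / m * (m / 2 * √m ^ ((m : ℤ) - 2) *
        ∫ x in Ω, lam x ^ ((m : ℤ) - 2) * normSqVariation g h Φ x ∂(riemannianVolume g))) 0 := by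
  have h1 := (hasDerivAt_setIntegral_of_contDiffAt (μ := riemannianVolume g) hΩ
    (F := fun t x => √(normSqD g h (Φ t) x) ^ (m : ℝ)) fun x => by
      simp only [Real.rpow_natCast]
      refine (((hΦ.contDiffAt_normSqD g h hΦ.zero_mem x (mem_chart_target _ x)).sqrt ?_).pow
        m).of_le (by norm_cast)
      simp only
      rw [hΦ.zero, hφ.normSqD_eq]
      exact mul_ne_zero (by exact_mod_cast hm) (pow_ne_zero _ (hφ.pos _).ne')).const_mul
        (1 / (m : ℝ))
  refine h1.congr_deriv ?_
  rw [← integral_const_mul (m / 2 * √m ^ ((m : ℤ) - 2))]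
  congr 1
  exact setIntegral_congr_fun hΩ.measurableSet fun x _ => (hΦ.hasDerivAt_pDensity hφ hm x).deriv

variable (g h) in
/-- The first variation of the energy density, integrated against the weight `w`, vanishes for
all compactly supported variations of `φ`. -/
def HasZeroFirstVariation (w : M → ℝ) (φ : M → N) : Prop :=
  ∀ Ω : Set M, IsCompact Ω → ∀ (ε : ℝ) (Φ : ℝ → M → N), IsVariation m n φ Ω ε Φ →
    ∫ x in Ω, w x * normSqVariation g h Φ x ∂(riemannianVolume g) = 0

lemma HasZeroFirstVariation.const_mul {w : M → ℝ} (hw : HasZeroFirstVariation g h w φ) (C : ℝ) :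
    HasZeroFirstVariation g h (fun x => C * w x) φ := fun Ω hΩ ε Φ hΦ => by
  simp only [mul_assoc]
  rw [integral_const_mul, hw Ω hΩ ε Φ hΦ, mul_zero]

/-- The common reduction for all the functionals: only the weight w survives, the nonzero constant C
being irrelevant. -/
lemma isCriticalMap_iff_of_hasDerivAt {𝓔 : Set M → (M → N) → ℝ} {w : M → ℝ}
    (hφ : ContMDiff (𝓡 m) (𝓡 n) ∞ φ) {C : ℝ} (hC : C ≠ 0)
    (hder : ∀ (Ω : Set M) (ε : ℝ) (Φ : ℝ → M → N), IsCompact Ω → IsVariation m n φ Ω ε Φ →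
      HasDerivAt (fun t => 𝓔 Ω (Φ t))
        (C * ∫ x in Ω, w x * normSqVariation g h Φ x ∂(riemannianVolume g)) 0) :
    IsCriticalMap m n 𝓔 φ ↔ HasZeroFirstVariation g h w φ := by
  constructor
  · rintro ⟨-, h1⟩ Ω hΩ ε Φ hΦ
    have h2 := (hder Ω ε Φ hΩ hΦ).unique (h1 Ω hΩ ε Φ hΦ)
    exact (mul_eq_zero.1 h2).resolve_left hC
  · refine fun h1 => ⟨hφ, fun Ω hΩ ε Φ hΦ => ?_⟩
    have h2 := hder Ω ε Φ hΩ hΦ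
    rwa [h1 Ω hΩ ε Φ hΦ, mul_zero] at h2

lemma isFHarmonic_iff (hφ : ContMDiff (𝓡 m) (𝓡 n) ∞ φ) (hf : ContMDiff (𝓡 m) 𝓘(ℝ, ℝ) ∞ f) :
    IsFHarmonic g h f φ ↔ HasZeroFirstVariation g h f φ :=
  isCriticalMap_iff_of_hasDerivAt hφ (one_div_ne_zero two_ne_zero)
    fun _ _ _ hΩ hΦ => hΦ.hasDerivAt_fEnergy hΩ hf

lemma IsConformalImmersion.isMinimalMap_iff (hφ : IsConformalImmersion g h φ lam) :
    IsMinimalMap g h φ ↔ HasZeroFirstVariation g h (fun x => lam x ^ ((m : ℤ) - 2)) φ :=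
  isCriticalMap_iff_of_hasDerivAt hφ.smooth (one_div_ne_zero two_ne_zero)
    fun _ _ _ hΩ hΦ => hΦ.hasDerivAt_volumeFunctional hΩ hφ

lemma IsConformalImmersion.isPHarmonic_iff (hφ : IsConformalImmersion g h φ lam) :
    IsPHarmonic g h (m : ℝ) φ ↔
      HasZeroFirstVariation g h (fun x => lam x ^ ((m : ℤ) - 2)) φ := by
  by_cases hm : m = 0
  · subst hm
    -- In dimension 0 both sides hold trivially: a trace of an empty matrix is 0, and the factor 1/p
    -- of the energy is 1/0 = 0.
    have h1 : ∀ (Φ : ℝ → M → N) (x : M), normSqVariation g h Φ x = 0 := fun Φ x => by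
      simp [normSqVariation, normSqD, Matrix.trace]
    refine iff_of_true ⟨hφ.smooth, fun Ω _ ε Φ _ => ?_⟩ fun Ω _ ε Φ _ => by simp [h1]
    simp only [pEnergy, Nat.cast_zero, div_zero, zero_mul]
    exact hasDerivAt_const _ _
  · have hm0 : (0 : ℝ) < m := by positivity
    refine isCriticalMap_iff_of_hasDerivAt hφ.smooth
      (C := 1 / m * (m / 2 * √m ^ ((m : ℤ) - 2))) (by positivity) fun Ω ε Φ hΩ hΦ => ?_
    rw [mul_assoc]
    exact hΦ.hasDerivAt_pEnergy hΩ hφ hm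

end CriticalPoints

/-! ### Compactly supported shifts of a vector space -/

section LocalShift

variable {E : Type*} [NormedAddCommGroup E] [NormedSpace ℝ E]

/-- The map `y ↦ y + t η(y) v`. -/
def localShift (η : E → ℝ) (v : E) (t : ℝ) (y : E) : E := y + (t * η y) • v

/-- Points off the support of η do not move, and a closed δ-neighbourhood of the compact support
still lies in U. -/
lemma exists_localShift_mem [ProperSpace E] {η : E → ℝ} (hη : Continuous η)
    (hc : HasCompactSupport η) {U : Set E} (hU : IsOpen U) (hηU : tsupport η ⊆ U) (v : E) :
    ∃ ε > 0, ∀ t ∈ Ioo (-ε) ε, ∀ y ∈ U, localShift η v t y ∈ U := by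
  obtain ⟨δ, hδ, hsub⟩ := hc.isCompact.exists_cthickening_subset_open hU hηU
  obtain ⟨B, hB⟩ := hη.bounded_above_of_compact_support hc
  have hB0 : 0 ≤ B := (norm_nonneg _).trans (hB 0)
  have hpos : 0 < B * ‖v‖ + 1 := by positivity
  -- With |η| ≤ B a point moves by at most |t|B‖v‖ ≤ δ; the 1 keeps the denominator positive.
  refine ⟨δ / (B * ‖v‖ + 1), by positivity, fun t ht y hy => ?_⟩
  by_cases hyη : y ∈ tsupport η
  · refine hsub (Metric.mem_cthickening_of_dist_le _ y _ _ hyη ?_)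
    rw [localShift, dist_eq_norm, add_sub_cancel_left, norm_smul, norm_mul, mul_assoc]
    have h1 : ‖t‖ ≤ δ / (B * ‖v‖ + 1) := (abs_lt.2 ht).le
    calc ‖t‖ * (‖η y‖ * ‖v‖) ≤ δ / (B * ‖v‖ + 1) * (B * ‖v‖ + 1) := by
          gcongr
          have := mul_le_mul_of_nonneg_right (hB y) (norm_nonneg v)
          linarith
      _ = δ := div_mul_cancel₀ _ hpos.ne'
  · simpa [localShift, image_eq_zero_of_notMem_tsupport hyη] using hy

lemma hasFDerivAt_localShift {η : E → ℝ} {y : E} (hη : DifferentiableAt ℝ η y) (v : E) (t : ℝ) :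
    HasFDerivAt (localShift η v t)
      (ContinuousLinearMap.id ℝ E + (t • fderiv ℝ η y).smulRight v) y :=
  (hasFDerivAt_id y).add ((hη.hasFDerivAt.const_mul t).smul_const v)

lemma det_id_add_smulRight [FiniteDimensional ℝ E] (l : E →L[ℝ] ℝ) (v : E) :
    (ContinuousLinearMap.id ℝ E + l.smulRight v).det = 1 + l v := by
  have h1 := LinearMap.transvection.det (R := ℝ) (V := E) (l : E →ₗ[ℝ] ℝ) v
  rw [← ContinuousLinearMap.coe_coe l, ← h1]
  rfl

end LocalShift

/-! ### Tangential variations and their effect on the volume density -/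

section Tangential

set_option linter.unusedSectionVars false

variable {m n : ℕ}
  {M : Type*} [TopologicalSpace M]
  [ChartedSpace (EuclideanSpace ℝ (Fin m)) M]
  [IsManifold (𝓡 m) ∞ M]
  {N : Type*} [TopologicalSpace N] [ChartedSpace (EuclideanSpace ℝ (Fin n)) N]
  [IsManifold (𝓡 n) ∞ N]
  {g : RMetric m M} {h : RMetric n N} {φ : M → N} {lam : M → ℝ} {f : M → ℝ}

open Classical in
/-- The variation of `φ` obtained by moving the points of a chart domain along `localShift`. -/
def tangentialVariation (φ : M → N) (x₀ : M) (η : EuclideanSpace ℝ (Fin m) → ℝ)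
    (v : EuclideanSpace ℝ (Fin m)) (t : ℝ) (x : M) : N :=
  if x ∈ (chartAt (EuclideanSpace ℝ (Fin m)) x₀).source then
    φ ((chartAt (EuclideanSpace ℝ (Fin m)) x₀).symm
      (localShift η v t (chartAt (EuclideanSpace ℝ (Fin m)) x₀ x)))
  else φ x

lemma tangentialVariation_of_notMem (x₀ : M) {η : EuclideanSpace ℝ (Fin m) → ℝ}
    (v : EuclideanSpace ℝ (Fin m)) (t : ℝ) {x : M}
    (hx : x ∉ (chartAt (EuclideanSpace ℝ (Fin m)) x₀).symm '' tsupport η) :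
    tangentialVariation φ x₀ η v t x = φ x := by
  unfold tangentialVariation
  split_ifs with hs
  · have h1 : chartAt (EuclideanSpace ℝ (Fin m)) x₀ x ∉ tsupport η := fun hmem =>
      hx ⟨_, hmem, (chartAt (EuclideanSpace ℝ (Fin m)) x₀).left_inv hs⟩
    rw [localShift, image_eq_zero_of_notMem_tsupport h1, mul_zero, zero_smul, add_zero,
      (chartAt (EuclideanSpace ℝ (Fin m)) x₀).left_inv hs]
  · rfl

lemma tangentialVariation_comp_chart_symm (x₀ : M) (η : EuclideanSpace ℝ (Fin m) → ℝ)
    (v : EuclideanSpace ℝ (Fin m)) (t : ℝ) {y : EuclideanSpace ℝ (Fin m)}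
    (hy : y ∈ (chartAt (EuclideanSpace ℝ (Fin m)) x₀).target) :
    tangentialVariation φ x₀ η v t ((chartAt (EuclideanSpace ℝ (Fin m)) x₀).symm y) =
      φ ((chartAt (EuclideanSpace ℝ (Fin m)) x₀).symm (localShift η v t y)) := by
  rw [tangentialVariation, if_pos ((chartAt (EuclideanSpace ℝ (Fin m)) x₀).map_target hy),
    (chartAt (EuclideanSpace ℝ (Fin m)) x₀).right_inv hy]

lemma isCompact_chart_symm_image (x₀ : M) {K : Set (EuclideanSpace ℝ (Fin m))} (hK : IsCompact K)
    (hKU : K ⊆ (chartAt (EuclideanSpace ℝ (Fin m)) x₀).target) :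
    IsCompact ((chartAt (EuclideanSpace ℝ (Fin m)) x₀).symm '' K) :=
  hK.image_of_continuousOn
    ((chartAt (EuclideanSpace ℝ (Fin m)) x₀).continuousOn_symm.mono hKU)

lemma exists_isVariation_tangentialVariation [T2Space M] (hφ : ContMDiff (𝓡 m) (𝓡 n) ∞ φ) (x₀ : M)
    {η : EuclideanSpace ℝ (Fin m) → ℝ} (hη : ContDiff ℝ ∞ η) (hc : HasCompactSupport η)
    (hηU : tsupport η ⊆ (chartAt (EuclideanSpace ℝ (Fin m)) x₀).target)
    (v : EuclideanSpace ℝ (Fin m)) :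
    ∃ ε, IsVariation m n φ ((chartAt (EuclideanSpace ℝ (Fin m)) x₀).symm '' tsupport η) ε
      (tangentialVariation φ x₀ η v) := by
  set c := chartAt (EuclideanSpace ℝ (Fin m)) x₀ with hcdef
  obtain ⟨ε, hε, hmem⟩ := exists_localShift_mem hη.continuous hc c.open_target hηU v
  have hΩ := isCompact_chart_symm_image x₀ hc.isCompact hηU
  refine ⟨ε, hε, ?_, ?_, fun t _ x hx => tangentialVariation_of_notMem x₀ v t hx⟩
  · rintro ⟨t, x⟩ ⟨ht, -⟩
    refine ContMDiffAt.contMDiffWithinAt ?_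
    by_cases hx : x ∈ c.source
    · have hev : (fun q : ℝ × M => tangentialVariation φ x₀ η v q.1 q.2) =ᶠ[nhds (t, x)]
          fun q => φ (c.symm (localShift η v q.1 (c q.2))) := by
        have : ∀ᶠ q : ℝ × M in nhds (t, x), q.2 ∈ c.source :=
          continuousAt_snd.preimage_mem_nhds (c.open_source.mem_nhds hx)
        filter_upwards [this] with q hq
        simp only [tangentialVariation]
        rw [if_pos hq]
      refine ContMDiffAt.congr_of_eventuallyEq ?_ hev
      have h1 : ContMDiffAt (𝓘(ℝ, ℝ).prod (𝓡 m)) (𝓡 m) ∞ (fun q : ℝ × M => c q.2) (t, x) :=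
        ContMDiffAt.comp (t, x) (contMDiffOn_chart.contMDiffAt (c.open_source.mem_nhds hx))
          contMDiffAt_snd
      have h2 : ContMDiffAt (𝓘(ℝ, ℝ).prod (𝓡 m)) (𝓡 m) ∞
          (fun q : ℝ × M => localShift η v q.1 (c q.2)) (t, x) := by
        have h3 : ContMDiffAt (𝓘(ℝ, ℝ).prod (𝓡 m)) 𝓘(ℝ, ℝ) ∞ (fun q : ℝ × M => η (c q.2)) (t, x) :=
          ContMDiffAt.comp (t, x) hη.contMDiff.contMDiffAt h1
        exact h1.add ((contMDiffAt_fst.smul h3).smul contMDiffAt_const)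
      have h4 : ContMDiffAt (𝓡 m) (𝓡 m) ∞ c.symm (localShift η v t (c x)) :=
        contMDiffOn_chart_symm.contMDiffAt
          (c.open_target.mem_nhds (hmem t ht _ (c.map_source hx)))
      exact ContMDiffAt.comp (t, x) (hφ _) (ContMDiffAt.comp (g := c.symm)
        (f := fun q : ℝ × M => localShift η v q.1 (c q.2)) (t, x) h4 h2)
    · have hxΩ : x ∉ c.symm '' tsupport η := by
        rintro ⟨y, hy, rfl⟩
        exact hx (c.map_target (hηU hy))
      have hev : (fun q : ℝ × M => tangentialVariation φ x₀ η v q.1 q.2) =ᶠ[nhds (t, x)]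
          fun q => φ q.2 := by
        -- Outside the chart the variation is locally constant in t: the image of the support is
        -- compact, hence closed as M is Hausdorff.
        have : ∀ᶠ q : ℝ × M in nhds (t, x), q.2 ∈ (c.symm '' tsupport η)ᶜ :=
          continuousAt_snd.preimage_mem_nhds (hΩ.isClosed.isOpen_compl.mem_nhds hxΩ)
        filter_upwards [this] with q hq
        exact tangentialVariation_of_notMem x₀ v q.1 hq
      refine ContMDiffAt.congr_of_eventuallyEq ?_ hev
      exact ContMDiffAt.comp (t, x) (hφ _) contMDiffAt_snd
  · ext x
    by_cases hx : x ∈ c.source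
    · rw [tangentialVariation, if_pos hx, localShift, zero_mul, zero_smul, add_zero, c.left_inv hx]
    · rw [tangentialVariation, if_neg hx]

/-- The density of the volume of `φ^* h` in the chart at `x₀`. -/
def pullbackDensity (h : RMetric n N) (φ : M → N) (x₀ : M) (y : EuclideanSpace ℝ (Fin m)) : ℝ :=
  √((pullbackGram (m := m) h (φ ∘ (chartAt (EuclideanSpace ℝ (Fin m)) x₀).symm) y).det)

/-- Transfers smoothness results for variations to φ itself. -/
lemma isVariation_const (hφ : ContMDiff (𝓡 m) (𝓡 n) ∞ φ) :
    IsVariation m n φ ∅ 1 (fun _ => φ) where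
  pos := one_pos
  smooth := (hφ.comp contMDiff_snd).contMDiffOn
  zero := rfl
  support _ _ _ _ := rfl

lemma IsConformalImmersion.det_pullbackGram_chart_pos (hφ : IsConformalImmersion g h φ lam)
    (x₀ : M) {y : EuclideanSpace ℝ (Fin m)}
    (hy : y ∈ (chartAt (EuclideanSpace ℝ (Fin m)) x₀).target) :
    0 < (pullbackGram (m := m) h (φ ∘ (chartAt (EuclideanSpace ℝ (Fin m)) x₀).symm) y).det := by
  have h1 := det_div_det_chart g h x₀ hy (hφ.mdifferentiableAt _)
  rw [hφ.det_div_det_eq, eq_div_iff (det_chartGram_pos g x₀ hy).ne'] at h1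
  rw [← h1]
  have := hφ.pos ((chartAt (EuclideanSpace ℝ (Fin m)) x₀).symm y)
  exact mul_pos (by positivity) (det_chartGram_pos g x₀ hy)

lemma IsConformalImmersion.contDiffAt_pullbackDensity (hφ : IsConformalImmersion g h φ lam)
    (x₀ : M) {y : EuclideanSpace ℝ (Fin m)}
    (hy : y ∈ (chartAt (EuclideanSpace ℝ (Fin m)) x₀).target) :
    ContDiffAt ℝ ∞ (pullbackDensity (m := m) h φ x₀) y := by
  have hv := isVariation_const hφ.smooth
  refine ContDiffAt.sqrt (contDiffAt_det fun i j => ?_) (hφ.det_pullbackGram_chart_pos x₀ hy).ne'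
  exact ContDiffAt.comp (f := fun y : EuclideanSpace ℝ (Fin m) => ((0 : ℝ), y))
    (g := fun q : ℝ × EuclideanSpace ℝ (Fin m) => pullbackGram (m := m) h
      (φ ∘ (chartAt (EuclideanSpace ℝ (Fin m)) x₀).symm) q.2 i j) y
    (hv.contDiffAt_pullbackGram_chart h hv.zero_mem x₀ hy i j)
    (contDiffAt_const.prodMk contDiffAt_id)

/-- No regularity of λ is assumed; it follows from |dφ|² = mλ² with λ > 0 when m > 0, and the model
space is a point when m = 0. -/
lemma IsConformalImmersion.contDiffAt_factor (hφ : IsConformalImmersion g h φ lam)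
    (x₀ : M) {y : EuclideanSpace ℝ (Fin m)}
    (hy : y ∈ (chartAt (EuclideanSpace ℝ (Fin m)) x₀).target) :
    ContDiffAt ℝ ∞ (fun y => lam ((chartAt (EuclideanSpace ℝ (Fin m)) x₀).symm y)) y := by
  rcases Nat.eq_zero_or_pos m with hm | hm
  · subst hm
    refine (contDiffAt_const (c := lam ((chartAt (EuclideanSpace ℝ (Fin 0)) x₀).symm
      y))).congr_of_eventuallyEq (Filter.Eventually.of_forall fun z => ?_)
    rw [Subsingleton.elim z y]
  · have hm0 : (0 : ℝ) < m := by exact_mod_cast hm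
    have hv := isVariation_const hφ.smooth
    have h1 : ContDiffAt ℝ ∞ (fun y => normSqD g h φ
        ((chartAt (EuclideanSpace ℝ (Fin m)) x₀).symm y)) y :=
      ContDiffAt.comp (f := fun y : EuclideanSpace ℝ (Fin m) => ((0 : ℝ), y))
        (g := fun q : ℝ × EuclideanSpace ℝ (Fin m) => normSqD g h φ
          ((chartAt (EuclideanSpace ℝ (Fin m)) x₀).symm q.2)) y
        (hv.contDiffAt_normSqD g h hv.zero_mem x₀ hy) (contDiffAt_const.prodMk contDiffAt_id)
    simp only [hφ.normSqD_eq] at h1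
    have hpos := hφ.pos ((chartAt (EuclideanSpace ℝ (Fin m)) x₀).symm y)
    refine ((h1.div_const (m : ℝ)).sqrt (by positivity)).congr_of_eventuallyEq
      (Filter.Eventually.of_forall fun z => ?_)
    beta_reduce
    rw [mul_div_cancel_left₀ _ hm0.ne', Real.sqrt_sq (hφ.pos _).le]

/-- The volume density of Φ_t is differentiated in two ways: by the conformal first variation
formula, and by writing it as det(1 + t dη ⊗ v)·ρ(y + tη(y)v), whose derivative at 0 is ρ dη(v) + η
dρ(v). -/
lemma IsConformalImmersion.density_mul_normSqVariation (hφ : IsConformalImmersion g h φ lam)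
    {x₀ : M} {η : EuclideanSpace ℝ (Fin m) → ℝ} (hη : ContDiff ℝ ∞ η)
    {v : EuclideanSpace ℝ (Fin m)} {Ω : Set M} {ε : ℝ}
    (hΦ : IsVariation m n φ Ω ε (tangentialVariation φ x₀ η v))
    {y : EuclideanSpace ℝ (Fin m)} (hy : y ∈ (chartAt (EuclideanSpace ℝ (Fin m)) x₀).target) :
    √((chartGram g x₀ y).det) * (1 / 2 *
      (lam ((chartAt (EuclideanSpace ℝ (Fin m)) x₀).symm y) ^ ((m : ℤ) - 2) *
        normSqVariation g h (tangentialVariation φ x₀ η v)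
          ((chartAt (EuclideanSpace ℝ (Fin m)) x₀).symm y))) =
      fderiv ℝ (fun y => pullbackDensity (m := m) h φ x₀ y * η y) y v := by
  set c := chartAt (EuclideanSpace ℝ (Fin m)) x₀ with hcdef
  set Φ := tangentialVariation φ x₀ η v with hΦdef
  set ρ := pullbackDensity (m := m) h φ x₀ with hρ
  have hηd : DifferentiableAt ℝ η y := hη.differentiable (by simp) y
  have hρd : DifferentiableAt ℝ ρ y := (hφ.contDiffAt_pullbackDensity x₀ hy).differentiableAt
    (by simp)
  have hleft := (hΦ.hasDerivAt_jacobianD hφ (c.symm y)).const_mul √((chartGram g x₀ y).det)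
  refine hleft.unique ?_
  have hshift : HasDerivAt (fun t => localShift η v t y) (η y • v) 0 := by
    have := (((hasDerivAt_id (0 : ℝ)).mul_const (η y)).smul_const v).const_add y
    simpa [localShift] using! this
  have hs0 : localShift η v 0 y = y := by simp [localShift]
  have hdet : HasDerivAt (fun t : ℝ => 1 + t * fderiv ℝ η y v) (fderiv ℝ η y v) 0 := by
    simpa using! ((hasDerivAt_id (0 : ℝ)).mul_const (fderiv ℝ η y v)).const_add 1
  have hρs : HasDerivAt (fun t => ρ (localShift η v t y)) (fderiv ℝ ρ y (η y • v)) 0 := by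
    have h1 : HasFDerivAt ρ (fderiv ℝ ρ y) (localShift η v 0 y) := by
      rw [hs0]; exact hρd.hasFDerivAt
    exact h1.comp_hasDerivAt 0 hshift
  have hright := hdet.mul hρs
  have hval : fderiv ℝ (fun y => ρ y * η y) y v =
      fderiv ℝ η y v * ρ (localShift η v 0 y) +
        (1 + 0 * fderiv ℝ η y v) * fderiv ℝ ρ y (η y • v) := by
    rw [hs0, fderiv_fun_mul hρd hηd]
    simp
    ring
  rw [hval]
  refine hright.congr_of_eventuallyEq ?_
  have e1 : ∀ᶠ t in nhds (0 : ℝ), t ∈ Ioo (-ε) ε := isOpen_Ioo.mem_nhds hΦ.zero_mem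
  -- For small t the determinant of the shift is positive, so the square root of its square needs no
  -- absolute value.
  have e2 : ∀ᶠ t in nhds (0 : ℝ), 0 < 1 + t * fderiv ℝ η y v :=
    hdet.continuousAt.eventually_const_lt (by simp)
  have e3 : ∀ᶠ t in nhds (0 : ℝ), localShift η v t y ∈ c.target :=
    hshift.continuousAt.preimage_mem_nhds (c.open_target.mem_nhds (by rwa [hs0]))
  filter_upwards [e1, e2, e3] with t h1 h2 h3
  have hsd := hasFDerivAt_localShift hηd v t
  have hev : Φ t ∘ c.symm =ᶠ[nhds y] (φ ∘ c.symm) ∘ localShift η v t := by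
    filter_upwards [c.open_target.mem_nhds hy] with z hz
    exact tangentialVariation_comp_chart_symm x₀ η v t hz
  have hφc : MDifferentiableAt (𝓡 m) (𝓡 n) (φ ∘ c.symm) (localShift η v t y) :=
    (hφ.mdifferentiableAt _).comp _ (mdifferentiableAt_chart_symm x₀ h3)
  rw [jacobianD, det_div_det_chart g h x₀ hy (hΦ.mdifferentiableAt h1 _),
    Real.sqrt_div' _ (det_chartGram_pos g x₀ hy).le,
    mul_div_cancel₀ _ (Real.sqrt_pos.2 (det_chartGram_pos g x₀ hy)).ne',
    pullbackGram_congr h hev, pullbackGram_comp h hφc hsd.differentiableAt.mdifferentiableAt,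
    jacMatrix_eq_fderiv, hsd.fderiv, Matrix.det_mul, Matrix.det_mul, Matrix.det_transpose,
    det_coordMatrix, det_id_add_smulRight, mul_right_comm, ← sq, Real.sqrt_mul (sq_nonneg _)]
  have h4 : (t • fderiv ℝ η y) v = t * fderiv ℝ η y v := rfl
  rw [h4, Real.sqrt_sq h2.le]
  rfl

end Tangential

/-! ### Integration by parts against test functions -/

/-- Integrating against the derivatives of all test functions supported in `U` characterizes the
functions with vanishing directional derivative in `U`. -/
lemma fderiv_apply_eq_zero_of_integral_mul_fderiv_eq_zero {E : Type*} [NormedAddCommGroup E]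
    [NormedSpace ℝ E] [FiniteDimensional ℝ E] [MeasurableSpace E] [BorelSpace E] {μ : Measure E}
    [μ.IsAddHaarMeasure] {U : Set E} (hU : IsOpen U) {u ρ : E → ℝ}
    (hu : ∀ y ∈ U, ContDiffAt ℝ ∞ u y) (hρ : ∀ y ∈ U, ContDiffAt ℝ ∞ ρ y)
    (hρ0 : ∀ y ∈ U, ρ y ≠ 0) (v : E)
    (hint : ∀ η : E → ℝ, ContDiff ℝ ∞ η → HasCompactSupport η → tsupport η ⊆ U →
      ∫ y, u y * fderiv ℝ (fun y => ρ y * η y) y v ∂μ = 0) :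
    ∀ y ∈ U, fderiv ℝ u y v = 0 := by
  have hdu : ContinuousOn (fun y => fderiv ℝ u y v) U := fun y hy =>
    ((((hu y hy).fderiv_right (m := 0) (by simp)).continuousAt).clm_apply
      continuousAt_const).continuousWithinAt
  have huc : ContinuousOn u U := fun y hy => (hu y hy).continuousAt.continuousWithinAt
  have hρc : ContinuousOn ρ U := fun y hy => (hρ y hy).continuousAt.continuousWithinAt
  have hF : ContinuousOn (fun y => fderiv ℝ u y v * ρ y) U := hdu.mul hρc
  have hae : ∀ᵐ y ∂μ, y ∈ U → fderiv ℝ u y v * ρ y = 0 := by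
    refine hU.ae_eq_zero_of_integral_contDiff_smul_eq_zero
      (hF.locallyIntegrableOn hU.measurableSet) fun η hη hc hηU => ?_
    -- Since η is supported inside U, b is globally smooth even though ρ is controlled only on U; so
    -- it is an admissible partner for integration by parts.
    set b : E → ℝ := fun y => ρ y * η y with hb
    have hsupp : tsupport b ⊆ tsupport η := tsupport_mul_subset_right
    have hbc : HasCompactSupport b := hc.mul_left
    have hbd : ContDiff ℝ ∞ b := by
      rw [contDiff_iff_contDiffAt]
      intro y
      by_cases hy : y ∈ U
      · exact (hρ y hy).mul hη.contDiffAt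
      · have h1 : b =ᶠ[nhds y] 0 := notMem_tsupport_iff_eventuallyEq.1
          fun h => hy (hηU (hsupp h))
        exact contDiffAt_const.congr_of_eventuallyEq h1
    have hprod : ∀ {a w : E → ℝ}, ContinuousOn a U → Continuous w → tsupport w ⊆ tsupport η →
        Integrable (fun y => a y * w y) μ := by
      intro a w ha hw hws
      refine Continuous.integrable_of_hasCompactSupport ?_ ?_
      · refine continuous_of_tsupport fun y hy => ?_
        exact (ha.continuousAt (hU.mem_nhds (hηU (hws (tsupport_mul_subset_right hy))))).mul
          hw.continuousAt
      · exact HasCompactSupport.mul_left (hc.of_isClosed_subset (isClosed_tsupport _) hws)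
    have hdb : Continuous fun y => fderiv ℝ b y v :=
      (hbd.continuous_fderiv (by simp)).clm_apply continuous_const
    have hdbs : tsupport (fun y => fderiv ℝ b y v) ⊆ tsupport η :=
      (tsupport_fderiv_apply_subset ℝ v).trans hsupp
    have key := integral_mul_fderiv_eq_neg_fderiv_mul_of_integrable (μ := μ) (f := u) (g := b)
      (v := v) (hprod hdu hbd.continuous hsupp) (hprod huc hdb hdbs)
      (hprod huc hbd.continuous hsupp)
      (fun y hy => (hu y (hηU (hsupp hy))).differentiableAt (by simp))
      (fun y _ => hbd.differentiable (by simp) y)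
    rw [hint η hη hc hηU] at key
    rw [← neg_eq_zero, key]
    congr 1
    refine integral_congr_ae (Filter.Eventually.of_forall fun y => ?_)
    simp only [hb, smul_eq_mul]
    ring
  have heq : EqOn (fun y => fderiv ℝ u y v * ρ y) 0 U := by
    refine Measure.eqOn_open_of_ae_eq (μ := μ) ?_ hU hF continuousOn_const
    exact (ae_restrict_iff' hU.measurableSet).2 hae
  exact fun y hy => (mul_eq_zero.1 (heq hy)).resolve_right (hρ0 y hy)

/-! ### Rigidity: the weight is determined up to a constant -/

section Rigidity

set_option linter.unusedSectionVars false

variable {m n : ℕ}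
  {M : Type*} [TopologicalSpace M] [T2Space M]
  [ChartedSpace (EuclideanSpace ℝ (Fin m)) M]
  [IsManifold (𝓡 m) ∞ M] [MeasurableSpace M] [BorelSpace M]
  {N : Type*} [TopologicalSpace N] [ChartedSpace (EuclideanSpace ℝ (Fin n)) N]
  [IsManifold (𝓡 n) ∞ N]
  {g : RMetric m M} {h : RMetric n N} {φ : M → N} {lam : M → ℝ} {f : M → ℝ}

lemma HasZeroFirstVariation.integral_mul_fderiv_eq_zero (hφ : IsConformalImmersion g h φ lam)
    (hf : ContMDiff (𝓡 m) 𝓘(ℝ, ℝ) ∞ f) (hzero : HasZeroFirstVariation g h f φ) (x₀ : M)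
    {η : EuclideanSpace ℝ (Fin m) → ℝ} (hη : ContDiff ℝ ∞ η) (hc : HasCompactSupport η)
    (hηU : tsupport η ⊆ (chartAt (EuclideanSpace ℝ (Fin m)) x₀).target)
    (v : EuclideanSpace ℝ (Fin m)) :
    ∫ y, f ((chartAt (EuclideanSpace ℝ (Fin m)) x₀).symm y) *
      (lam ((chartAt (EuclideanSpace ℝ (Fin m)) x₀).symm y) ^ ((m : ℤ) - 2))⁻¹ *
      fderiv ℝ (fun y => pullbackDensity (m := m) h φ x₀ y * η y) y v = 0 := by
  set c := chartAt (EuclideanSpace ℝ (Fin m)) x₀ with hcdef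
  obtain ⟨ε, hΦ⟩ := exists_isVariation_tangentialVariation hφ.smooth x₀ hη hc hηU v
  set Φ := tangentialVariation φ x₀ η v with hΦdef
  have hΩ := isCompact_chart_symm_image x₀ hc.isCompact hηU
  have hΩs : c.symm '' tsupport η ⊆ c.source := by
    rintro _ ⟨y, hy, rfl⟩
    exact c.map_target (hηU hy)
  have hoff : ∀ x, x ∉ c.symm '' tsupport η → normSqVariation g h Φ x = 0 := by
    intro x hx
    have h1 : ∀ t, normSqD g h (Φ t) x = normSqD g h φ x := fun t => by
      have hev : Φ t =ᶠ[nhds x] φ := by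
        filter_upwards [hΩ.isClosed.isOpen_compl.mem_nhds hx] with z hz
        exact tangentialVariation_of_notMem x₀ v t hz
      rw [normSqD, pullbackGram_congr h hev]
      rfl
    simp [normSqVariation, h1]
  have hmeas : Measurable fun x => f x * normSqVariation g h Φ x :=
    (hf.continuous.mul hΦ.continuous_normSqVariation).measurable
  have h1 := hzero _ hΩ ε Φ hΦ
  -- The first variation vanishes off the support, so the integral extends to the whole chart domain
  -- and passes to coordinates.
  rw [← setIntegral_eq_of_subset_of_forall_sdiff_eq_zero c.open_source.measurableSet hΩs
    (fun x hx => by rw [hoff x hx.2, mul_zero]), setIntegral_source_riemannianVolume g x₀ hmeas]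
    at h1
  -- The factor 2 absorbs the ½ in `density_mul_normSqVariation`.
  rw [← setIntegral_eq_integral_of_forall_compl_eq_zero (s := c.target), ← mul_eq_zero_iff_left
    (two_ne_zero : (2 : ℝ) ≠ 0), ← h1, ← integral_const_mul]
  · refine setIntegral_congr_fun c.open_target.measurableSet fun y hy => ?_
    beta_reduce
    rw [← hφ.density_mul_normSqVariation hη hΦ hy]
    have hne : lam (c.symm y) ^ ((m : ℤ) - 2) ≠ 0 := zpow_ne_zero _ (hφ.pos _).ne'
    rw [← hcdef, ← hΦdef]
    field_simp
  · intro y hy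
    have h2 : fderiv ℝ (fun y => pullbackDensity (m := m) h φ x₀ y * η y) y = 0 := by
      refine image_eq_zero_of_notMem_tsupport fun hmem => hy (hηU ?_)
      exact tsupport_mul_subset_right (tsupport_fderiv_subset ℝ hmem)
    rw [h2]
    simp

theorem HasZeroFirstVariation.exists_eq_const_mul [ConnectedSpace M]
    (hφ : IsConformalImmersion g h φ lam) (hf : ContMDiff (𝓡 m) 𝓘(ℝ, ℝ) ∞ f)
    (hzero : HasZeroFirstVariation g h f φ) :
    ∃ C : ℝ, ∀ x, f x = C * lam x ^ ((m : ℤ) - 2) := by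
  let u : M → ℝ := fun x => f x * (lam x ^ ((m : ℤ) - 2))⁻¹
  have hloc : IsLocallyConstant u := by
    refine (IsLocallyConstant.iff_eventually_eq u).2 fun x₀ => ?_
    set c := chartAt (EuclideanSpace ℝ (Fin m)) x₀ with hcdef
    have hu : ∀ y ∈ c.target, ContDiffAt ℝ ∞ (u ∘ c.symm) y := fun y hy => by
      have h1 := hφ.contDiffAt_factor x₀ hy
      have h2 := (hφ.pos (c.symm y)).ne'
      have h3 : ContDiffAt ℝ ∞ (fun y => lam (c.symm y) ^ ((m : ℤ) - 2)) y := by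
        have h4 : ∀ z, lam (c.symm z) ^ ((m : ℤ) - 2) =
            lam (c.symm z) ^ m * (lam (c.symm z) ^ 2)⁻¹ := fun z => by
          rw [zpow_sub₀ (hφ.pos _).ne', zpow_natCast, div_eq_mul_inv]
          norm_cast
        simp only [h4]
        exact (h1.pow m).mul ((h1.pow 2).inv (pow_ne_zero 2 h2))
      exact (contDiffAt_comp_chart_symm hf x₀ hy).mul (h3.inv (zpow_ne_zero _ h2))
    have hder : ∀ v, ∀ y ∈ c.target, fderiv ℝ (u ∘ c.symm) y v = 0 := fun v =>
      fderiv_apply_eq_zero_of_integral_mul_fderiv_eq_zero (μ := volume) c.open_target hu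
        (fun y hy => hφ.contDiffAt_pullbackDensity x₀ hy)
        (fun y hy => (Real.sqrt_pos.2 (hφ.det_pullbackGram_chart_pos x₀ hy)).ne') v
        fun η hη hc hηU => hzero.integral_mul_fderiv_eq_zero hφ hf x₀ hη hc hηU v
    have hx₀ : x₀ ∈ c.source := mem_chart_source _ x₀
    -- The chart target may be disconnected, so constancy is deduced on a ball.
    obtain ⟨r, hr, hball⟩ := Metric.isOpen_iff.1 c.open_target (c x₀) (c.map_source hx₀)
    have hconst := fun y (hy : y ∈ Metric.ball (c x₀) r) =>
      Metric.isOpen_ball.is_const_of_fderiv_eq_zero (𝕜 := ℝ) (f := u ∘ c.symm)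
        (convex_ball (c x₀) r).isPreconnected
        (fun z hz => ((hu z (hball hz)).differentiableAt (by simp)).differentiableWithinAt)
        (fun z hz => ContinuousLinearMap.ext fun v => hder v z (hball hz)) hy
        (Metric.mem_ball_self hr)
    filter_upwards [c.open_source.mem_nhds hx₀,
      (c.continuousAt hx₀).preimage_mem_nhds (Metric.ball_mem_nhds _ hr)] with x hx hxr
    have := hconst (c x) hxr
    simpa only [Function.comp, c.left_inv hx, c.left_inv hx₀] using this
  obtain ⟨C, hC⟩ := hloc.exists_eq_const
  refine ⟨C, fun x => ?_⟩
  have h1 : f x * (lam x ^ ((m : ℤ) - 2))⁻¹ = C := congrFun hC x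
  rw [← h1, inv_mul_cancel_right₀ (zpow_ne_zero _ (hφ.pos x).ne')]

end Rigidity

/-! ### The isometric case and the conclusion -/

lemma IsIsometricImmersion.isConformalImmersion {m n : ℕ}
    {M : Type*} [TopologicalSpace M] [ChartedSpace (EuclideanSpace ℝ (Fin m)) M]
    [IsManifold (𝓡 m) ∞ M]
    {N : Type*} [TopologicalSpace N] [ChartedSpace (EuclideanSpace ℝ (Fin n)) N]
    [IsManifold (𝓡 n) ∞ N] {g : RMetric m M} {h : RMetric n N} {φ : M → N}
    (hφ : IsIsometricImmersion g h φ) : IsConformalImmersion g h φ fun _ => 1 where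
  smooth := hφ.smooth
  immersion := hφ.immersion
  pos _ := one_pos
  pullback x v w := by rw [hφ.pullback x v w, one_pow, one_mul]

end

theorem mainTheorem4 {m n : ℕ}
    {M : Type*} [TopologicalSpace M] [T2Space M] [SecondCountableTopology M] [ConnectedSpace M]
    [ChartedSpace (EuclideanSpace ℝ (Fin m)) M] [IsManifold (𝓡 m) ∞ M]
    [MeasurableSpace M] [BorelSpace M]
    {N : Type*} [TopologicalSpace N] [T2Space N] [SecondCountableTopology N]
    [ChartedSpace (EuclideanSpace ℝ (Fin n)) N] [IsManifold (𝓡 n) ∞ N]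
    (g : RMetric m M) (h : RMetric n N) (φ : M → N)
    (f : M → ℝ) (hf : ContMDiff (𝓡 m) 𝓘(ℝ, ℝ) ∞ f) (hfpos : ∀ x, 0 < f x) :
    (∀ lam : M → ℝ, IsConformalImmersion g h φ lam →
      (IsFHarmonic g h f φ ↔
        IsPHarmonic g h (m : ℝ) φ ∧ ∃ C : ℝ, ∀ x, f x = C * lam x ^ ((m : ℤ) - 2)) ∧
      (IsPHarmonic g h (m : ℝ) φ ↔ IsMinimalMap g h φ)) ∧
    (IsIsometricImmersion g h φ →
      (IsFHarmonic g h f φ ↔ (∃ C : ℝ, ∀ x, f x = C) ∧ IsHarmonicMap g h φ)) := by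
  have key : ∀ lam : M → ℝ, IsConformalImmersion g h φ lam →
      (HasZeroFirstVariation g h f φ ↔
        HasZeroFirstVariation g h (fun x => lam x ^ ((m : ℤ) - 2)) φ ∧
          ∃ C : ℝ, ∀ x, f x = C * lam x ^ ((m : ℤ) - 2)) := by
    refine fun lam hφ => ⟨fun h1 => ?_, fun ⟨h1, C, hC⟩ => ?_⟩
    · obtain ⟨C, hC⟩ := h1.exists_eq_const_mul hφ hf
      refine ⟨?_, C, hC⟩
      -- Positivity of f at one point excludes C = 0, so λ^(m-2) = C⁻¹f inherits the vanishing first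
      -- variation.
      have hC0 : C ≠ 0 := by
        rintro rfl
        obtain ⟨x⟩ := (inferInstance : Nonempty M)
        have := hfpos x
        rw [hC x, zero_mul] at this
        exact this.false
      convert h1.const_mul C⁻¹ using 2 with x
      rw [hC x, inv_mul_cancel_left₀ hC0]
    · convert h1.const_mul C using 2 with x
      exact hC x
  refine ⟨fun lam hφ => ⟨?_, ?_⟩, fun hφ => ?_⟩
  · rw [isFHarmonic_iff hφ.smooth hf, hφ.isPHarmonic_iff, key lam hφ]
  · rw [hφ.isPHarmonic_iff, hφ.isMinimalMap_iff]
  -- For λ = 1 the weight λ^(m-2) is 1, which is the weight of the harmonic energy in every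
  -- dimension.
  · have h1 := key _ hφ.isConformalImmersion
    simp only [one_zpow, mul_one] at h1
    have h2 : IsHarmonicMap g h φ ↔ HasZeroFirstVariation g h (fun _ => 1) φ :=
      isFHarmonic_iff hφ.smooth contMDiff_const
    rw [isFHarmonic_iff hφ.smooth hf, h1, h2, and_comm]
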